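/- Let $H:\mathbb R^d\times\mathbb R^q\to\mathbb R^d$ be Borel, let $U$ and $U^n$ ($n\ge1$) be $\mathbb R^q$-valued random vectors, and put $h(\theta)=\mathbb E[H(\theta,U)]$, $h^n(\theta)=\mathbb E[H(\theta,U^n)]$. Let $h(\theta^*)=0$, $h^n(\theta^{*,n})=0$, $\Gamma(\theta)=\mathbb E[H(\theta,U)H(\theta,U)^T]$, and let $\alpha>0$. Assume: 1. $\langle\theta-\theta^*,h(\theta)\rangle>0$ for $\theta\ne\theta^*$, and $\langle\theta-\theta^{*,n},h^n(\theta)\rangle>0$ for $\theta\neq\theta^{*,n}$, $n\ge 1$; $h$ is $C^1$ and is $C^2$ in a neighborhood of $\theta^*$; each $h^n$ is $C^2$, and the $Dh^n$ are Lipschitz with a constant independent of $n$; $h^n\to h$ and $Dh^n\to Dh$ locally uniformly; $Dh(\theta^*)$ is non-singular and all its eigenvalues have positive real parts; and for every $\theta\in\mathbb R^d$ the limit $\mathcal E(h,\alpha,\theta):=\lim_n n^\alpha(h^n(\theta)-h(\theta))$ exists in $\mathbb R^d$. 2. $\theta\mapsto\mathbb E|H(\theta,U)|^{2+\varepsilon}$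 is locally bounded for some $\varepsilon>0$; $\Gamma$ is continuous and $\Gamma(\theta^*)$ is positive definite. 3. (HR) For some $b\in(0,1]$, $\displaystyle\sup_{n\ge1,\ \theta\neq\theta'}\frac{\mathbb E|H(\theta,U^n)-H(\theta',U^n)|^2}{|\theta-\theta'|^{2b}}<\infty$. 4. (HI) For some $\delta>0$, $\sup_{n\ge1,\,|\theta|\le R}\mathbb E|H(\theta,U^n)|^{2+\delta}<\infty$ for every $R>0$; and $\theta\mapsto\mathbb E[H(\theta,U^n)H(\theta,U^n)^T]$ converges to $\Gamma$ locally uniformly as $n\to\infty$. 5. (HMR) For some $\underline\lambda>0$, $\langle\theta-\theta^{*,n},h^n(\theta)\rangle\ge\underline\lambda|\theta-\theta^{*,n}|^2$ for all $n\ge1$ and $\theta\in\mathbb R^d$. 6. (HS1) $\gamma_p=\gamma(p)$, $p\ge1$, where $\gamma$ is a positive function on $[0,\infty)$, decreasing to zero, with $\lim_{t\to\infty}\gamma(tx)/\gamma(t)=x^{-a}$ for every $x>0$, for some $a\in(1/2,1)$. For each $n\ge1$ let $((U^n)^p)_{p\ge1}$ be i.i.d. copies of $U^n$, let $\theta^n_0$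 be independent of this sequence, with $\sup_n\mathbb E|\theta^n_0|^2<\infty$, and set $$\theta^n_{p+1}=\theta^n_p-\gamma_{p+1}H\big(\theta^n_p,(U^n)^{p+1}\big),\qquad \bar\theta^n_p=\frac{\theta^n_0+\theta^n_1+\cdots+\theta^n_p}{p+1},\qquad p\ge0 .$$ Then, as $n\to\infty$, with $n^{2\alpha}$ read as $\lfloor n^{2\alpha}\rfloor$ in the index, $$n^\alpha\big(\bar\theta^n_{n^{2\alpha}}-\theta^*\big)\Longrightarrow -Dh(\theta^*)^{-1}\mathcal E(h,\alpha,\theta^*)+\mathcal N\!\left(0,\;Dh(\theta^*)^{-1}\Gamma(\theta^*)\big(Dh(\theta^*)^{-1}\big)^T\right)$$ in law. Moreover, if the simulation of one copy of $U^n$ costs $K n$ with a constant $K>0$, the cost of simulating the $\lfloor n^{2\alpha}\rfloor$ innovations is asymptotically equivalent to $K n^{2\alpha+1}$, for every such step function $\gamma$. -/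

import Mathlib

open MeasureTheory ProbabilityTheory Filter Asymptotics
open scoped Topology NNReal ENNReal

namespace StochApprox

noncomputable section

/-- The space `ℝ^k` with its Euclidean norm. -/
abbrev Vec (k : ℕ) : Type := EuclideanSpace ℝ (Fin k)

/-- The mean field `θ ↦ 𝔼[H(θ, U)]`. -/
def meanField {Ω : Type*} [MeasurableSpace Ω] (P : Measure Ω) {d q : ℕ}
    (H : Vec d → Vec q → Vec d) (U : Ω → Vec q) (θ : Vec d) : Vec d :=
  ∫ ω, H θ (U ω) ∂P

/-- The matrix `𝔼[H(θ, U) H(θ, U)ᵀ]`. -/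
def secondMoment {Ω : Type*} [MeasurableSpace Ω] (P : Measure Ω) {d q : ℕ}
    (H : Vec d → Vec q → Vec d) (U : Ω → Vec q) (θ : Vec d) : Matrix (Fin d) (Fin d) ℝ :=
  Matrix.of fun i j => ∫ ω, H θ (U ω) i * H θ (U ω) j ∂P

/-- The moment `𝔼[|H(θ, U)|^p]`, with values in `[0, ∞]`. -/
def absMoment {Ω : Type*} [MeasurableSpace Ω] (P : Measure Ω) {d q : ℕ}
    (H : Vec d → Vec q → Vec d) (U : Ω → Vec q) (p : ℝ) (θ : Vec d) : ℝ≥0∞ :=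
  ∫⁻ ω, ‖H θ (U ω)‖ₑ ^ p ∂P

/-- The Jacobian matrix `Df(x)`, with entries `∂f_i/∂x_j`. -/
def jacobian {d : ℕ} (f : Vec d → Vec d) (x : Vec d) : Matrix (Fin d) (Fin d) ℝ :=
  Matrix.of fun i j => fderiv ℝ f x (EuclideanSpace.single j 1) i

/-- All (complex) eigenvalues of the real matrix `A` have positive real part. -/
def IsStable {d : ℕ} (A : Matrix (Fin d) (Fin d) ℝ) : Prop :=
  ∀ z ∈ spectrum ℂ (A.map (algebraMap ℝ ℂ)), 0 < z.re

/-- The mean-reverting assumption for `f` at `x₀`; it forces `x₀` to be the only possible zero. -/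
def MeanReverting {d : ℕ} (f : Vec d → Vec d) (x₀ : Vec d) : Prop :=
  ∀ θ, θ ≠ x₀ → 0 < inner ℝ (θ - x₀) (f θ)

/-- `γ` is a positive function on `[0, ∞)`, decreasing to zero and
varying regularly with exponent `-a`. -/
structure IsRegVaryingStep (γ : ℝ → ℝ) (a : ℝ) : Prop where
  pos : ∀ t, 0 ≤ t → 0 < γ t
  antitoneOn : AntitoneOn γ (Set.Ici 0)
  tendsto_zero : Tendsto γ atTop (𝓝 0)
  regVarying : ∀ x : ℝ, 0 < x → Tendsto (fun t => γ (t * x) / γ t) atTop (𝓝 (x ^ (-a)))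

/-- The stochastic approximation scheme `θ_{p+1} = θ_p - γ(p+1) H(θ_p, u_p)` started at `x₀`.
The innovation `u p` is the one numbered `p + 1` in the usual numbering from `1`. -/
def schemeIter {d q : ℕ} (H : Vec d → Vec q → Vec d) (γ : ℝ → ℝ) (x₀ : Vec d) (u : ℕ → Vec q) :
    ℕ → Vec d
  | 0 => x₀
  | p + 1 => schemeIter H γ x₀ u p - γ ((p : ℝ) + 1) • H (schemeIter H γ x₀ u p) (u p)

/-- The empirical mean `(θ_0 + ⋯ + θ_p) / (p + 1)` of the scheme. -/
def average {d q : ℕ} (H : Vec d → Vec q → Vec d) (γ : ℝ → ℝ) (x₀ : Vec d) (u : ℕ → Vec q)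
    (p : ℕ) : Vec d :=
  ((p : ℝ) + 1)⁻¹ • ∑ k ∈ Finset.range (p + 1), schemeIter H γ x₀ u k

/-- The number `⌊n^{2α}⌋` of iterations. -/
def numSteps (α : ℝ) (n : ℕ) : ℕ := ⌊(n : ℝ) ^ (2 * α)⌋₊

/-- The cost of simulating the innovations of `M` iterations,
when one copy of `Uⁿ` is simulated at cost `K * n`. -/
def simulationCost (K : ℝ) (n M : ℕ) : ℝ := ∑ _p ∈ Finset.range M, K * (n : ℝ)

end

end StochApprox

/-!
A central limit theorem for the averaged Robbins–Monro scheme whose target is biased.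

Fix `n`, put `c = θ*ⁿ`, `f = hⁿ`, `B = Df(c)` and `Y_k = θ_k - c`. Dividing the recursion by the
step and isolating the linear part gives

  `B Y_k + H(c, u_k) = (Y_k - Y_{k+1}) / γ_{k+1} - (f(θ_k) - B Y_k) - ζ_k`,

where `ζ_k = H(θ_k, u_k) - H(c, u_k) - f(θ_k)` is a martingale increment. After summation over
`k < m`, the right-hand side is `o(√m)` in `L¹`, uniformly in `n`
(`StochApprox.exists_linearization_error`). All three terms are controlled by the single bound
`𝔼|Y_k|² ≤ K γ_k` with `K` independent of `n`:

* the first one is summed by parts and is `O(1/√γ_m)`, which is `o(√m)` because `a < 1`;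
* the Taylor remainder is `O(∑ γ_k)`, which is `o(√m)` because `a > 1/2`;
* the `ζ_k` are orthogonal and the Hölder condition gives `𝔼|ζ_k|² ≤ C (K γ_k)^b → 0`, so that
  their sum is `o(√m)` in `L²`.

The bound on `𝔼|Y_k|²` comes from the contraction that uniform mean reversion provides, by a
discrete Gronwall lemma (`StochApprox.IsRegVaryingStep.exists_le_mul_of_rec`). Regular variation
does not make `γ_k / γ_{k+1} - 1` of order `1 / k`, so the comparison there is not with `γ` itself
but with a sequence of the same order that has this property.

What is left of the average of the `Y_k` is `-B⁻¹` applied to the average of the variables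
`H(c, u_k)`, which are i.i.d. in each row, centred, and bounded in `L^{2+δ}`. Lyapunov's theorem
applies (`StochApprox.tendstoInDistribution_smul_sum`), and the covariances converge because
`θ*ⁿ → θ*`, `Dhⁿ → Dh` and `Γⁿ → Γ` locally uniformly. Finally mean reversion gives
`|θ*ⁿ - θ*| ≤ |hⁿ(θ*)| / λ = O(n^{-α})`, and a Taylor expansion of `hⁿ` at `θ*ⁿ` identifies the
limit of `n^α (θ*ⁿ - θ*)` as `-Dh(θ*)⁻¹ ℰ(h, α, θ*)` (`StochApprox.tendsto_smul_zero_sub`). The two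
limits are added by Slutsky's theorem (`StochApprox.tendstoInDistribution_average`).
-/

namespace StochApprox

noncomputable section

/-! ### Regularly varying steps -/

namespace IsRegVaryingStep

variable {γ : ℝ → ℝ} {a : ℝ}

lemma tendsto_two (hγ : IsRegVaryingStep γ a) :
    Tendsto (fun t => γ (2 * t) / γ t) atTop (𝓝 ((2 : ℝ) ^ (-a))) := by
  simpa [mul_comm] using hγ.regVarying 2 two_pos

/-- One half of a Potter bound: iterate along dyadic points the comparison
`γ(2t) ≥ 2^{-c} γ(t)`, valid for large `t` as soon as `c > a`. -/
lemma exists_le_mul (hγ : IsRegVaryingStep γ a) {c : ℝ} (hc : 0 ≤ c) (hac : a < c) :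
    ∃ T : ℝ, 1 ≤ T ∧ ∀ s t, T ≤ s → s ≤ t → γ s ≤ (2 * (t / s)) ^ c * γ t := by
  have h2 : (2 : ℝ) ^ (-c) < 2 ^ (-a) :=
    Real.rpow_lt_rpow_of_exponent_lt (by norm_num) (by linarith)
  obtain ⟨T, hT⟩ := eventually_atTop.1 (hγ.tendsto_two.eventually (lt_mem_nhds h2))
  have hdouble : ∀ t, max T 1 ≤ t → γ t ≤ 2 ^ c * γ (2 * t) := by
    intro t ht
    have ht0 : (0 : ℝ) < t := lt_of_lt_of_le one_pos ((le_max_right _ _).trans ht)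
    have := hT t ((le_max_left _ _).trans ht)
    rw [lt_div_iff₀ (hγ.pos t ht0.le), Real.rpow_neg (by norm_num)] at this
    have h2c : (0 : ℝ) < 2 ^ c := by positivity
    calc γ t = 2 ^ c * ((2 ^ c)⁻¹ * γ t) := by field_simp
      _ ≤ 2 ^ c * γ (2 * t) := by gcongr
  have hiter : ∀ s, max T 1 ≤ s → ∀ k : ℕ, γ s ≤ (2 ^ k) ^ c * γ (2 ^ k * s) := by
    intro s hs k
    have hs0 : (0 : ℝ) < s := lt_of_lt_of_le one_pos ((le_max_right _ _).trans hs)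
    induction k with
    | zero => simp
    | succ k ih =>
      have h1 : (1 : ℝ) ≤ 2 ^ k := one_le_pow₀ (by norm_num)
      have := hdouble (2 ^ k * s) (hs.trans (by nlinarith))
      calc γ s ≤ (2 ^ k) ^ c * γ (2 ^ k * s) := ih
        _ ≤ (2 ^ k) ^ c * (2 ^ c * γ (2 * (2 ^ k * s))) := by gcongr
        _ = (2 ^ (k + 1)) ^ c * γ (2 ^ (k + 1) * s) := by
          rw [pow_succ, Real.mul_rpow (by positivity) (by norm_num)]
          ring_nf
  refine ⟨max T 1, le_max_right _ _, fun s t hs hst => ?_⟩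
  have hs0 : (0 : ℝ) < s := lt_of_lt_of_le one_pos ((le_max_right _ _).trans hs)
  obtain ⟨k, hk1, hk2⟩ := exists_nat_pow_near ((one_le_div hs0).2 hst) one_lt_two
  rw [div_lt_iff₀ hs0] at hk2
  have ht0 : 0 < t := hs0.trans_le hst
  have h3 : (2 : ℝ) ^ (k + 1) ≤ 2 * (t / s) := by rw [pow_succ]; linarith
  calc γ s ≤ (2 ^ (k + 1)) ^ c * γ (2 ^ (k + 1) * s) := hiter s hs (k + 1)
    _ ≤ (2 * (t / s)) ^ c * γ t := by
      gcongr
      · exact (hγ.pos _ (by positivity)).le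
      · exact hγ.antitoneOn (hs0.le.trans hst) (Set.mem_Ici.2 (by positivity)) hk2.le

/-- The other half of a Potter bound: `γ(t) = O(t^{-c})` for every `c < a`. -/
lemma exists_le_rpow (hγ : IsRegVaryingStep γ a) {c : ℝ} (hc : 0 ≤ c) (hca : c < a) :
    ∃ C : ℝ, ∃ T : ℝ, 1 ≤ T ∧ ∀ t, T ≤ t → γ t ≤ C * t ^ (-c) := by
  have h2 : (2 : ℝ) ^ (-a) < 2 ^ (-c) :=
    Real.rpow_lt_rpow_of_exponent_lt (by norm_num) (by linarith)
  obtain ⟨T, hT⟩ := eventually_atTop.1 (hγ.tendsto_two.eventually (gt_mem_nhds h2))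
  have hdouble : ∀ t, max T 1 ≤ t → γ (2 * t) ≤ 2 ^ (-c) * γ t := by
    intro t ht
    have ht0 : (0 : ℝ) < t := lt_of_lt_of_le one_pos ((le_max_right _ _).trans ht)
    have := hT t ((le_max_left _ _).trans ht)
    rw [div_lt_iff₀ (hγ.pos t ht0.le)] at this
    exact this.le
  set S := max T 1
  have hS0 : (0 : ℝ) < S := lt_of_lt_of_le one_pos (le_max_right _ _)
  have hiter : ∀ k : ℕ, γ (2 ^ k * S) ≤ (2 ^ k) ^ (-c) * γ S := by
    intro k
    induction k with
    | zero => simp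
    | succ k ih =>
      have h1 : (1 : ℝ) ≤ 2 ^ k := one_le_pow₀ (by norm_num)
      have := hdouble (2 ^ k * S) (by nlinarith)
      calc γ (2 ^ (k + 1) * S) = γ (2 * (2 ^ k * S)) := by ring_nf
        _ ≤ 2 ^ (-c) * γ (2 ^ k * S) := this
        _ ≤ 2 ^ (-c) * ((2 ^ k) ^ (-c) * γ S) := by gcongr
        _ = (2 ^ (k + 1)) ^ (-c) * γ S := by
          rw [pow_succ, Real.mul_rpow (by positivity) (by norm_num)]
          ring
  refine ⟨(2 * S) ^ c * γ S, S, le_max_right _ _, fun t ht => ?_⟩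
  have ht0 : 0 < t := hS0.trans_le ht
  obtain ⟨k, hk1, hk2⟩ := exists_nat_pow_near ((one_le_div hS0).2 ht) one_lt_two
  have h3 : t / (2 * S) ≤ 2 ^ k := by
    rw [pow_succ] at hk2
    rw [div_le_iff₀ (by positivity)]
    rw [div_lt_iff₀ hS0] at hk2
    linarith
  rw [le_div_iff₀ hS0] at hk1
  have hp := (hγ.pos S hS0.le).le
  calc γ t ≤ γ (2 ^ k * S) :=
        hγ.antitoneOn (Set.mem_Ici.2 (by positivity)) ht0.le hk1
    _ ≤ (2 ^ k) ^ (-c) * γ S := hiter k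
    _ ≤ (t / (2 * S)) ^ (-c) * γ S := by
      gcongr ?_ * _
      exact Real.rpow_le_rpow_of_nonpos (by positivity) h3 (by linarith)
    _ = (2 * S) ^ c * γ S * t ^ (-c) := by
      rw [Real.div_rpow ht0.le (by positivity), Real.rpow_neg (by positivity : (0:ℝ) ≤ 2 * S)]
      field_simp

lemma antitone_nat (hγ : IsRegVaryingStep γ a) : Antitone fun k : ℕ => γ k := fun i j hij =>
  hγ.antitoneOn (Set.mem_Ici.2 (Nat.cast_nonneg i)) (Set.mem_Ici.2 (Nat.cast_nonneg j))
    (by exact_mod_cast hij)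

lemma pos_nat (hγ : IsRegVaryingStep γ a) (k : ℕ) : 0 < γ k := hγ.pos _ (Nat.cast_nonneg k)

lemma tendsto_nat (hγ : IsRegVaryingStep γ a) : Tendsto (fun k : ℕ => γ k) atTop (𝓝 0) :=
  hγ.tendsto_zero.comp tendsto_natCast_atTop_atTop

/-- For `a < 1` the sequence `k γ(k)` is increasing up to a constant factor. -/
lemma exists_mul_le (hγ : IsRegVaryingStep γ a) (ha : a < 1) :
    ∃ N : ℕ, 1 ≤ N ∧ ∀ j p : ℕ, N ≤ j → j ≤ p → (j : ℝ) * γ j ≤ 2 * (p * γ p) := by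
  obtain ⟨T, hT1, hT⟩ := hγ.exists_le_mul zero_le_one ha
  refine ⟨⌈T⌉₊, by simpa using hT1.trans_lt' one_pos, fun j p hj hp => ?_⟩
  have hj' : T ≤ j := Nat.ceil_le.1 hj
  have hj0 : (0 : ℝ) < j := by linarith
  have := hT j p hj' (by exact_mod_cast hp)
  rw [Real.rpow_one] at this
  calc (j : ℝ) * γ j ≤ j * (2 * (p / j) * γ p) := by gcongr
    _ = 2 * (p * γ p) := by field_simp

lemma tendsto_mul_atTop (hγ : IsRegVaryingStep γ a) (ha0 : 0 ≤ a) (ha : a < 1) :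
    Tendsto (fun k : ℕ => (k : ℝ) * γ k) atTop atTop := by
  obtain ⟨c, hac, hc1⟩ := exists_between ha
  obtain ⟨T, hT1, hT⟩ := hγ.exists_le_mul (ha0.trans hac.le) hac
  have hT0 : 0 < T := by linarith
  have hγT := hγ.pos T hT0.le
  set q : ℝ := (2 / T) ^ c
  have hq : 0 < q := by positivity
  have hlim : Tendsto (fun k : ℕ => q⁻¹ * γ T * (k : ℝ) ^ (1 - c)) atTop atTop :=
    ((tendsto_rpow_atTop (by linarith)).comp tendsto_natCast_atTop_atTop).const_mul_atTop
      (by positivity)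
  refine tendsto_atTop_mono' _ ?_ hlim
  filter_upwards [eventually_ge_atTop ⌈T⌉₊] with k hk
  have hk' : T ≤ k := Nat.ceil_le.1 hk
  have hk0 : (0 : ℝ) < k := by linarith
  have h1 := hT T k le_rfl hk'
  have h2 : (2 * ((k : ℝ) / T)) ^ c = q * (k : ℝ) ^ c := by
    rw [← Real.mul_rpow (by positivity) hk0.le]; congr 1; ring
  rw [h2] at h1
  rw [Real.rpow_sub hk0, Real.rpow_one]
  have h3 : (0 : ℝ) < (k : ℝ) ^ c := by positivity
  calc q⁻¹ * γ T * (k / (k : ℝ) ^ c) ≤ q⁻¹ * (q * (k : ℝ) ^ c * γ k) * (k / (k : ℝ) ^ c) := by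
        gcongr
    _ = k * γ k := by field_simp

lemma exists_ratio_le (hγ : IsRegVaryingStep γ a) (ha : a < 1) :
    ∃ C : ℝ, 1 ≤ C ∧ ∀ k : ℕ, γ k ≤ C * γ ((k : ℝ) + 1) := by
  obtain ⟨N, hN1, hN⟩ := hγ.exists_mul_le ha
  have hN0 := hγ.pos_nat N
  refine ⟨max 4 (γ 0 / γ N), by simp, fun k => ?_⟩
  have hk1 : 0 < γ ((k : ℝ) + 1) := hγ.pos _ (by positivity)
  rcases lt_or_ge k N with hk | hk
  · have h1 : γ k ≤ γ 0 := by simpa using hγ.antitone_nat (Nat.zero_le k)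
    have h2 : γ N ≤ γ ((k : ℝ) + 1) := by simpa using hγ.antitone_nat (Nat.succ_le_of_lt hk)
    have h0 : 0 < γ 0 := hγ.pos 0 le_rfl
    calc γ k ≤ γ 0 / γ N * γ N := by rw [div_mul_cancel₀ _ hN0.ne']; exact h1
      _ ≤ max 4 (γ 0 / γ N) * γ ((k : ℝ) + 1) := by
        gcongr
        exact le_max_right _ _
  · have h1 := hN k (k + 1) hk (Nat.le_succ k)
    have hk0 : (1 : ℝ) ≤ k := by exact_mod_cast hN1.trans hk
    push_cast at h1
    have h2 : γ k ≤ 4 * γ ((k : ℝ) + 1) := by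
      have : (k : ℝ) * γ k ≤ k * (4 * γ ((k : ℝ) + 1)) := by nlinarith
      exact le_of_mul_le_mul_left this (by linarith)
    exact h2.trans (by gcongr; exact le_max_left _ _)

/-- For `a < 1` one has `1 / √γ(m) = o(√m)`. -/
lemma tendsto_inv_sqrt (hγ : IsRegVaryingStep γ a) (ha0 : 0 ≤ a) (ha : a < 1) :
    Tendsto (fun m : ℕ => (√m)⁻¹ * (√(γ m))⁻¹) atTop (𝓝 0) := by
  have := (Real.tendsto_sqrt_atTop.comp (hγ.tendsto_mul_atTop ha0 ha)).inv_tendsto_atTop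
  refine this.congr fun m => ?_
  simp [Real.sqrt_mul, mul_comm]

lemma sum_inv_sqrt_le (m : ℕ) : ∑ k ∈ Finset.range m, (√((k : ℝ) + 1))⁻¹ ≤ 2 * √m := by
  induction m with
  | zero => simp
  | succ m ih =>
    rw [Finset.sum_range_succ]
    push_cast
    set x := √(m : ℝ)
    set y := √((m : ℝ) + 1)
    have hx : x ^ 2 = m := Real.sq_sqrt (Nat.cast_nonneg m)
    have hy : y ^ 2 = m + 1 := Real.sq_sqrt (by positivity)
    have hy0 : 0 < y := Real.sqrt_pos.2 (by positivity)
    have hx0 : 0 ≤ x := Real.sqrt_nonneg _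
    have : y⁻¹ ≤ 2 * (y - x) := by
      rw [inv_le_iff_one_le_mul₀ hy0]
      nlinarith [sq_nonneg (y - x)]
    linarith

lemma sqrt_le_sum_inv_sqrt (m : ℕ) : √m ≤ ∑ k ∈ Finset.range m, (√((k : ℝ) + 1))⁻¹ := by
  induction m with
  | zero => simp
  | succ m ih =>
    rw [Finset.sum_range_succ]
    push_cast
    set x := √(m : ℝ)
    set y := √((m : ℝ) + 1)
    have hx : x ^ 2 = m := Real.sq_sqrt (Nat.cast_nonneg m)
    have hy : y ^ 2 = m + 1 := Real.sq_sqrt (by positivity)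
    have hy0 : 0 < y := Real.sqrt_pos.2 (by positivity)
    have hx0 : 0 ≤ x := Real.sqrt_nonneg _
    have hxy : x ≤ y := Real.sqrt_le_sqrt (by linarith)
    have : y - x ≤ y⁻¹ := by
      rw [← one_div, le_div_iff₀ hy0]
      nlinarith
    linarith

/-- For `a > 1/2` the steps sum up to `o(√m)`. -/
lemma tendsto_sum (hγ : IsRegVaryingStep γ a) (ha : 1 / 2 < a) :
    Tendsto (fun m : ℕ => (√m)⁻¹ * ∑ k ∈ Finset.range m, γ k) atTop (𝓝 0) := by
  obtain ⟨c, hc, hca⟩ := exists_between ha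
  obtain ⟨C, T, hT1, hT⟩ := hγ.exists_le_rpow (by linarith) hca
  have h1 : (fun k : ℕ => γ k) =o[atTop] fun k : ℕ => (√((k : ℝ) + 1))⁻¹ := by
    rw [isLittleO_iff_tendsto' (Eventually.of_forall fun k hk => by
      have : (0 : ℝ) < √((k : ℝ) + 1) := Real.sqrt_pos.2 (by positivity)
      simp [this.ne'] at hk)]
    have hlim : Tendsto (fun k : ℕ => C * 2 * (k : ℝ) ^ (-(c - 1 / 2))) atTop (𝓝 0) := by
      simpa using ((tendsto_rpow_neg_atTop (by linarith : 0 < c - 1 / 2)).comp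
        tendsto_natCast_atTop_atTop).const_mul (C * 2)
    refine squeeze_zero' (Eventually.of_forall fun k => ?_) ?_ hlim
    · have := (hγ.pos_nat k).le
      positivity
    · filter_upwards [eventually_ge_atTop ⌈T⌉₊] with k hk
      have hk' : T ≤ k := Nat.ceil_le.1 hk
      have hk1 : (1 : ℝ) ≤ k := hT1.trans hk'
      have hk0 : (0 : ℝ) < k := by linarith
      have h2 : √((k : ℝ) + 1) ≤ 2 * (k : ℝ) ^ (1 / 2 : ℝ) := by
        rw [← Real.sqrt_eq_rpow]
        refine Real.sqrt_le_iff.2 ⟨by positivity, ?_⟩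
        rw [mul_pow, Real.sq_sqrt hk0.le]; linarith
      have hpos := (hγ.pos_nat k).le
      rw [div_inv_eq_mul]
      calc γ k * √((k : ℝ) + 1) ≤ (C * (k : ℝ) ^ (-c)) * (2 * (k : ℝ) ^ (1 / 2 : ℝ)) := by
            gcongr
            · exact hpos.trans (hT k hk')
            · exact hT k hk'
        _ = C * 2 * ((k : ℝ) ^ (-c) * (k : ℝ) ^ (1 / 2 : ℝ)) := by ring
        _ = C * 2 * (k : ℝ) ^ (-(c - 1 / 2)) := by
          rw [← Real.rpow_add hk0]; congr 2; ring
  have hsq : Tendsto (fun m : ℕ => √(m : ℝ)) atTop atTop :=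
    Real.tendsto_sqrt_atTop.comp tendsto_natCast_atTop_atTop
  have h2 := h1.sum_range (fun k => by positivity) (tendsto_atTop_mono sqrt_le_sum_inv_sqrt hsq)
  have h3 : (fun m : ℕ => ∑ k ∈ Finset.range m, (√((k : ℝ) + 1))⁻¹) =O[atTop]
      fun m : ℕ => √(m : ℝ) := by
    refine IsBigO.of_bound 2 (Eventually.of_forall fun m => ?_)
    rw [Real.norm_of_nonneg (Finset.sum_nonneg fun _ _ => by positivity),
      Real.norm_of_nonneg (by positivity)]
    exact sum_inv_sqrt_le m
  have h4 := (h2.trans_isBigO h3).tendsto_div_nhds_zero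
  exact h4.congr fun m => by rw [div_eq_inv_mul]

/-- A discrete Gronwall lemma. If `u` contracts by `1 - 2λγ + O(γ²)` up to an error `O(γ²)`, then
`u = O(γ)`, with a constant that depends only on the bounds. The comparison sequence
`g(p) = p⁻¹ max_{N ≤ j ≤ p} j γ(j)` is of the order of `γ` and, unlike `γ`, which may have
comparatively large jumps, its relative decrease is at most `1 / p = o(γ(p))`. -/
lemma exists_le_mul_of_rec (hγ : IsRegVaryingStep γ a) (ha0 : 0 ≤ a) (ha : a < 1)
    {lam C C₀ : ℝ} (hlam : 0 < lam) (hC : 0 ≤ C) (hC₀ : 0 ≤ C₀) :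
    ∃ K : ℝ, 0 ≤ K ∧ ∀ u : ℕ → ℝ, (∀ k, 0 ≤ u k) → u 0 ≤ C₀ →
      (∀ k : ℕ, u (k + 1) ≤ (1 - 2 * lam * γ ((k : ℝ) + 1) + C * γ ((k : ℝ) + 1) ^ 2) * u k
        + C * γ ((k : ℝ) + 1) ^ 2) → ∀ k : ℕ, u k ≤ K * γ k := by
  obtain ⟨N₁, hN₁, hmono⟩ := hγ.exists_mul_le ha
  have hs0 := hγ.tendsto_nat
  have hev := ((hs0.const_mul C).eventually (gt_mem_nhds (by simpa using hlam))).and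
    (((hs0.const_mul lam).eventually (gt_mem_nhds (by simp : lam * 0 < (1 : ℝ)))).and
    ((hγ.tendsto_mul_atTop ha0 ha).eventually_ge_atTop (4 / lam)))
  obtain ⟨N₂, hN₂⟩ := eventually_atTop.1 hev
  set N := max N₁ N₂
  have hN1 : 1 ≤ N := hN₁.trans (le_max_left _ _)
  set q := C * γ 0 ^ 2
  have hq : 0 ≤ q := by positivity
  set X := (1 + q) ^ N * (C₀ + 1)
  have hX : 0 ≤ X := by positivity
  have hγN := hγ.pos_nat N
  set K₀ := max (X / γ N) (2 * C / lam)
  have hK₀ : 0 ≤ K₀ := le_max_of_le_left (by positivity)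
  refine ⟨2 * K₀, by positivity, fun u hu hu0 hrec => ?_⟩
  have hsmall : ∀ k : ℕ, u k + 1 ≤ (1 + q) ^ k * (C₀ + 1) := by
    intro k
    induction k with
    | zero => simpa using hu0
    | succ k ih =>
      have h1 : 0 < γ ((k : ℝ) + 1) := hγ.pos _ (by positivity)
      have h2 : γ ((k : ℝ) + 1) ≤ γ 0 := by simpa using hγ.antitone_nat (Nat.zero_le (k + 1))
      have h3 : C * γ ((k : ℝ) + 1) ^ 2 ≤ q := by simp only [q]; gcongr
      have h4 : (1 - 2 * lam * γ ((k : ℝ) + 1) + C * γ ((k : ℝ) + 1) ^ 2) * u k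
          ≤ (1 + q) * u k := by
        have : 0 < lam * γ ((k : ℝ) + 1) := by positivity
        gcongr
        · exact hu k
        · linarith
      calc u (k + 1) + 1 ≤ (1 + q) * u k + q + 1 := by linarith [hrec k]
        _ = (1 + q) * (u k + 1) := by ring
        _ ≤ (1 + q) * ((1 + q) ^ k * (C₀ + 1)) := by gcongr
        _ = _ := by ring
  have hinit : ∀ k ≤ N, u k ≤ K₀ * γ k := by
    intro k hk
    have h1 : γ N ≤ γ k := hγ.antitone_nat hk
    have h2 : (1 + q) ^ k ≤ (1 + q) ^ N := pow_le_pow_right₀ (by linarith) hk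
    calc u k ≤ (1 + q) ^ k * (C₀ + 1) := by linarith [hsmall k]
      _ ≤ X := by simp only [X]; gcongr
      _ = X / γ N * γ N := by field_simp
      _ ≤ K₀ * γ k := by gcongr; exact le_max_left _ _
  -- `G p` is the maximum of `j γ(j)` over `N ≤ j ≤ N + p`
  set G := partialSups fun j : ℕ => ((N + j : ℕ) : ℝ) * γ ((N + j : ℕ) : ℝ)
  have hGle : ∀ p, G p ≤ 2 * (((N + p : ℕ) : ℝ) * γ ((N + p : ℕ) : ℝ)) := fun p =>
    partialSups_le _ _ _ fun j hj => hmono _ _ (by omega) (by omega)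
  have hleG : ∀ p, ((N + p : ℕ) : ℝ) * γ ((N + p : ℕ) : ℝ) ≤ G p := fun p =>
    le_partialSups (fun j : ℕ => ((N + j : ℕ) : ℝ) * γ ((N + j : ℕ) : ℝ)) p
  have hmain : ∀ p, u (N + p) ≤ K₀ * G p / (N + p : ℕ) := by
    intro p
    induction p with
    | zero =>
      have hN0 : (0 : ℝ) < (N : ℕ) := by exact_mod_cast hN1
      have := hleG 0
      rw [add_zero] at this ⊢
      refine (hinit N le_rfl).trans ?_
      rw [le_div_iff₀ hN0]
      calc K₀ * γ N * N = K₀ * (N * γ N) := by ring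
        _ ≤ K₀ * G 0 := by gcongr
    | succ p ih =>
      obtain ⟨hC1, hl1, hl4⟩ := hN₂ (N + (p + 1)) (by omega)
      have hcast : ((N + (p + 1) : ℕ) : ℝ) = ((N + p : ℕ) : ℝ) + 1 := by push_cast; ring
      have hr := hrec (N + p)
      have hG1 := hleG (p + 1)
      have hGm : G p ≤ G (p + 1) := G.monotone (Nat.le_succ p)
      rw [← add_assoc] at hC1 hl1 hl4 hG1 ⊢
      have hcast' : ((N + p + 1 : ℕ) : ℝ) = ((N + p : ℕ) : ℝ) + 1 := by push_cast; ring
      rw [hcast'] at hC1 hl1 hl4 hG1 ⊢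
      set Q : ℝ := ((N + p : ℕ) : ℝ)
      set s := γ (Q + 1)
      set G' := G (p + 1)
      have hQ : 1 ≤ Q := by simp only [Q]; exact_mod_cast (by omega : 1 ≤ N + p)
      have hs : 0 < s := hγ.pos _ (by linarith)
      have hG'0 : 0 < G' := lt_of_lt_of_le (by positivity) hG1
      have h1 : u (N + p) ≤ K₀ * G' / Q := ih.trans (by gcongr)
      have h2 : 2 * C ≤ K₀ * lam := by
        have : 2 * C / lam ≤ K₀ := le_max_right _ _
        rwa [div_le_iff₀ hlam] at this
      have h3 : 1 - 2 * lam * s + C * s ^ 2 ≤ 1 - lam * s := by nlinarith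
      have h4 : (1 - lam * s) * (1 + lam * s / 2) ≤ 1 - lam * s / 2 := by
        nlinarith [sq_nonneg (lam * s)]
      have h5 : (Q + 1) / Q ≤ 1 + lam * s / 2 := by
        rw [div_le_iff₀ hlam] at hl4
        rw [div_le_iff₀ (by linarith)]
        nlinarith
      rw [le_div_iff₀ (by linarith)]
      have h6 : C * s ^ 2 * (Q + 1) ≤ K₀ * (lam * s / 2) * G' := by
        calc C * s ^ 2 * (Q + 1) = C * s * ((Q + 1) * s) := by ring
          _ ≤ C * s * G' := by gcongr
          _ ≤ K₀ * lam / 2 * s * G' := by gcongr; linarith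
          _ = _ := by ring
      calc u (N + p + 1) * (Q + 1)
          ≤ ((1 - lam * s) * (K₀ * G' / Q) + C * s ^ 2) * (Q + 1) := by
            gcongr
            refine hr.trans ?_
            gcongr ?_ + _
            exact (mul_le_mul_of_nonneg_right h3 (hu _)).trans
              (mul_le_mul_of_nonneg_left h1 (by linarith))
        _ = K₀ * G' * ((1 - lam * s) * ((Q + 1) / Q)) + C * s ^ 2 * (Q + 1) := by ring
        _ ≤ K₀ * G' * ((1 - lam * s) * (1 + lam * s / 2)) + K₀ * (lam * s / 2) * G' := by
            gcongr
        _ ≤ K₀ * G' * (1 - lam * s / 2) + K₀ * (lam * s / 2) * G' := by gcongr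
        _ = K₀ * G' := by ring
  intro k
  have hk0 := (hγ.pos_nat k).le
  rcases le_total k N with hk | hk
  · exact (hinit k hk).trans (by nlinarith)
  · obtain ⟨p, rfl⟩ := Nat.exists_eq_add_of_le hk
    have hpos : (0 : ℝ) < (N + p : ℕ) := by exact_mod_cast (by omega : 0 < N + p)
    refine (hmain p).trans ?_
    rw [div_le_iff₀ hpos]
    calc K₀ * G p ≤ K₀ * (2 * (((N + p : ℕ) : ℝ) * γ ((N + p : ℕ) : ℝ))) := by gcongr; exact hGle p
      _ = _ := by ring

/-- The telescoping bound behind summation by parts: since `γ(k) / γ(k+1)` is bounded,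
`√γ(k) (1/γ(k+1) - 1/γ(k))` is at most a constant times an increment of `1/√γ`. -/
lemma sum_sqrt_mul_le (hγ : IsRegVaryingStep γ a) {C : ℝ} (hC : 1 ≤ C)
    (hratio : ∀ k : ℕ, γ k ≤ C * γ ((k : ℝ) + 1)) (m : ℕ) :
    ∑ k ∈ Finset.range m, √(γ k) * ((γ ((k : ℝ) + 1))⁻¹ - (γ k)⁻¹) ≤ (1 + C) * (√(γ m))⁻¹ := by
  induction m with
  | zero =>
    have := hγ.pos 0 le_rfl
    simp only [Finset.range_zero, Finset.sum_empty]
    positivity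
  | succ m ih =>
    rw [Finset.sum_range_succ]
    push_cast
    set x := √(γ m)
    set y := √(γ ((m : ℝ) + 1))
    have hx0 : 0 < x := Real.sqrt_pos.2 (hγ.pos_nat m)
    have hy0 : 0 < y := Real.sqrt_pos.2 (hγ.pos _ (by positivity))
    have hx : x ^ 2 = γ m := Real.sq_sqrt (hγ.pos_nat m).le
    have hy : y ^ 2 = γ ((m : ℝ) + 1) := Real.sq_sqrt (hγ.pos _ (by positivity)).le
    have hyx : y ≤ x :=
      Real.sqrt_le_sqrt (by simpa using hγ.antitone_nat (Nat.le_succ m))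
    have hr : x ^ 2 ≤ C * y ^ 2 := by rw [hx, hy]; exact hratio m
    have hxy : x ≤ C * y := by
      refine (sq_le_sq₀ hx0.le (by positivity)).1 ?_
      nlinarith [mul_pos hy0 hy0]
    have h1 : x * ((γ ((m : ℝ) + 1))⁻¹ - (γ m)⁻¹) = (y⁻¹ - x⁻¹) * (1 + x / y) := by
      rw [← hx, ← hy]; field_simp; ring
    have h2 : 0 ≤ y⁻¹ - x⁻¹ := sub_nonneg.2 (inv_anti₀ hy0 hyx)
    have h3 : x / y ≤ C := (div_le_iff₀ hy0).2 hxy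
    have h4 : (y⁻¹ - x⁻¹) * (1 + x / y) ≤ (y⁻¹ - x⁻¹) * (1 + C) := by gcongr
    rw [h1]
    linarith

end IsRegVaryingStep

/-! ### A central limit theorem for row-wise i.i.d. arrays -/

/-- A version of `Complex.tendsto_one_add_pow_exp_of_tendsto` with general exponents. -/
lemma tendsto_one_add_pow_exp {g : ℕ → ℂ} {m : ℕ → ℕ} {t : ℂ} (hm : Tendsto m atTop atTop)
    (hg : Tendsto (fun n => (m n : ℂ) * g n) atTop (𝓝 t)) :
    Tendsto (fun n => (1 + g n) ^ m n) atTop (𝓝 (Complex.exp t)) := by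
  have hm' : Tendsto (fun n => ((m n : ℂ))⁻¹) atTop (𝓝 0) :=
    (tendsto_inv_atTop_nhds_zero_nat (𝕜 := ℂ)).comp hm
  have hg0 : Tendsto g atTop (𝓝 0) := by
    have := hg.mul hm'
    rw [mul_zero] at this
    refine this.congr' ?_
    filter_upwards [hm.eventually_ge_atTop 1] with n hn
    have : (m n : ℂ) ≠ 0 := by exact_mod_cast (by omega : m n ≠ 0)
    field_simp
  have hlog : Tendsto (fun n => (m n : ℂ) * Complex.log (1 + g n)) atTop (𝓝 t) := by
    have h1 : (fun n => (m n : ℂ) * (Complex.log (1 + g n) - g n)) =O[atTop]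
        fun n => ((m n : ℂ) * g n) * g n := by
      have := (isBigO_refl (fun n => (m n : ℂ)) atTop).mul
        (Complex.log_sub_self_isBigO.comp_tendsto hg0)
      refine this.congr_right fun n => ?_
      simp only [Function.comp]
      ring
    have h2 := h1.trans_tendsto (by simpa using hg.mul hg0)
    simpa [mul_sub] using hg.add h2
  refine ((Complex.continuous_exp.tendsto _).comp hlog).congr' ?_
  filter_upwards [hg0.eventually_ne (show (0 : ℂ) ≠ -1 by simp)] with n hn
  have : 1 + g n ≠ 0 := fun h => hn (by linear_combination h)
  simp only [Function.comp]
  rw [Complex.exp_nat_mul, Complex.exp_log this]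

lemma norm_exp_mul_I_sub_le (x : ℝ) {δ : ℝ} (hδ0 : 0 ≤ δ) (hδ1 : δ ≤ 1) :
    ‖Complex.exp (x * Complex.I) - (1 + x * Complex.I - (x ^ 2 : ℝ) / 2)‖ ≤ 4 * |x| ^ (2 + δ) := by
  rcases le_total |x| 1 with hx | hx
  · have hn : ‖(x : ℂ) * Complex.I‖ = |x| := by simp
    have h := Complex.exp_bound (x := (x : ℂ) * Complex.I) (by rw [hn]; exact hx) (n := 3)
      (by norm_num)
    have hs : ∑ m ∈ Finset.range 3, ((x : ℂ) * Complex.I) ^ m / (m.factorial : ℂ)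
        = 1 + x * Complex.I - (x ^ 2 : ℝ) / 2 := by
      simp [Finset.sum_range_succ, mul_pow, Nat.factorial]
      ring
    rw [hs, hn] at h
    have h1 : |x| ^ 3 ≤ |x| ^ (2 + δ) := by
      rcases (abs_nonneg x).eq_or_lt with h0 | h0
      · rw [← h0, Real.zero_rpow (by linarith)]; norm_num
      · rw [← Real.rpow_natCast]
        exact Real.rpow_le_rpow_of_exponent_ge h0 hx (by push_cast; linarith)
    refine h.trans ?_
    norm_num [Nat.factorial]
    nlinarith [pow_nonneg (abs_nonneg x) 3]
  · have h1 : |x| ^ 2 ≤ |x| ^ (2 + δ) := by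
      rw [← Real.rpow_natCast]
      exact Real.rpow_le_rpow_of_exponent_le hx (by push_cast; linarith)
    have h2 : ‖Complex.exp (x * Complex.I) - (1 + x * Complex.I - (x ^ 2 : ℝ) / 2)‖
        ≤ 1 + (1 + |x| + |x| ^ 2 / 2) := by
      refine (norm_sub_le _ _).trans ?_
      rw [Complex.norm_exp_ofReal_mul_I]
      gcongr
      refine (norm_sub_le _ _).trans ?_
      gcongr
      · refine (norm_add_le _ _).trans ?_
        simp
      · simp
    nlinarith

section CentralLimit

variable {Ω : Type*} [MeasurableSpace Ω] {P : Measure Ω}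

/-- A quantitative second order expansion of the characteristic function of a centred variable. -/
lemma norm_integral_exp_sub_le [IsProbabilityMeasure P] {X : Ω → ℝ} (hX : AEMeasurable X P)
    {δ : ℝ} (hδ0 : 0 ≤ δ) (hδ1 : δ ≤ 1) (hint : Integrable (fun ω => |X ω| ^ (2 + δ)) P)
    (h0 : ∫ ω, X ω ∂P = 0) (τ : ℝ) :
    ‖∫ ω, Complex.exp ((τ * X ω : ℝ) * Complex.I) ∂P
        - (1 - ((τ ^ 2 * ∫ ω, X ω ^ 2 ∂P : ℝ) : ℂ) / 2)‖
      ≤ 4 * (|τ| ^ (2 + δ) * ∫ ω, |X ω| ^ (2 + δ) ∂P) := by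
  have hb : Integrable (fun ω => 1 + |X ω| ^ (2 + δ)) P := (integrable_const 1).add hint
  have hX1 : Integrable X P := by
    refine hb.mono' hX.aestronglyMeasurable (Eventually.of_forall fun ω => ?_)
    rw [Real.norm_eq_abs]
    rcases le_total |X ω| 1 with h | h
    · have : 0 ≤ |X ω| ^ (2 + δ) := by positivity
      linarith
    · have : |X ω| ^ (1 : ℝ) ≤ |X ω| ^ (2 + δ) := Real.rpow_le_rpow_of_exponent_le h (by linarith)
      rw [Real.rpow_one] at this
      linarith
  have hX2 : Integrable (fun ω => X ω ^ 2) P := by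
    refine hb.mono' (hX.pow_const 2).aestronglyMeasurable (Eventually.of_forall fun ω => ?_)
    rw [norm_pow, Real.norm_eq_abs]
    rcases le_total |X ω| 1 with h | h
    · have : 0 ≤ |X ω| ^ (2 + δ) := by positivity
      have := pow_le_one₀ (n := 2) (abs_nonneg (X ω)) h
      linarith
    · have : |X ω| ^ (2 : ℝ) ≤ |X ω| ^ (2 + δ) := Real.rpow_le_rpow_of_exponent_le h (by linarith)
      rw [Real.rpow_two] at this
      linarith
  have hexp : Integrable (fun ω => Complex.exp ((τ * X ω : ℝ) * Complex.I)) P := by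
    refine Integrable.mono' (integrable_const (1 : ℝ)) ?_ (Eventually.of_forall fun ω => ?_)
    · have : AEMeasurable (fun ω => Complex.exp ((τ * X ω : ℝ) * Complex.I)) P := by fun_prop
      exact this.aestronglyMeasurable
    · rw [Complex.norm_exp_ofReal_mul_I]
  have hlin : Integrable (fun ω => ((τ * X ω : ℝ) : ℂ) * Complex.I) P :=
    ((hX1.const_mul τ).ofReal).mul_const _
  have hquad : Integrable (fun ω => (((τ * X ω) ^ 2 : ℝ) : ℂ) / 2) P := by
    simp_rw [mul_pow]
    exact ((hX2.const_mul (τ ^ 2)).ofReal).div_const _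
  have hpoly : Integrable (fun ω => 1 + ((τ * X ω : ℝ) : ℂ) * Complex.I
      - (((τ * X ω) ^ 2 : ℝ) : ℂ) / 2) P := ((integrable_const 1).add hlin).sub hquad
  have hval : ∫ ω, (1 + ((τ * X ω : ℝ) : ℂ) * Complex.I - (((τ * X ω) ^ 2 : ℝ) : ℂ) / 2) ∂P
      = 1 - ((τ ^ 2 * ∫ ω, X ω ^ 2 ∂P : ℝ) : ℂ) / 2 := by
    rw [integral_sub (f := fun ω => 1 + ((τ * X ω : ℝ) : ℂ) * Complex.I)
      ((integrable_const 1).add hlin) hquad, integral_add (integrable_const 1) hlin,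
      integral_mul_const, integral_complex_ofReal, integral_const_mul, h0, integral_div,
      integral_complex_ofReal]
    simp_rw [mul_pow]
    rw [integral_const_mul]
    simp
  rw [← hval, ← integral_sub hexp hpoly]
  have hbound : ∀ ω, ‖Complex.exp ((τ * X ω : ℝ) * Complex.I) - (1 + ((τ * X ω : ℝ) : ℂ) * Complex.I
      - (((τ * X ω) ^ 2 : ℝ) : ℂ) / 2)‖ ≤ 4 * (|τ| ^ (2 + δ) * |X ω| ^ (2 + δ)) := fun ω => by
    refine (norm_exp_mul_I_sub_le (τ * X ω) hδ0 hδ1).trans_eq ?_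
    rw [abs_mul, Real.mul_rpow (abs_nonneg _) (abs_nonneg _)]
  calc _ ≤ ∫ ω, 4 * (|τ| ^ (2 + δ) * |X ω| ^ (2 + δ)) ∂P :=
        norm_integral_le_of_norm_le ((hint.const_mul _).const_mul _) (Eventually.of_forall hbound)
    _ = _ := by rw [integral_const_mul, integral_const_mul]

variable {E : Type*} [NormedAddCommGroup E] [InnerProductSpace ℝ E] [FiniteDimensional ℝ E]
  [MeasurableSpace E] [BorelSpace E]

lemma charFun_map_smul_sum {X : ℕ → Ω → E} {W : Ω → E} (hX : ∀ k, IdentDistrib (X k) W P P)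
    (hindep : iIndepFun X P) (τ : ℝ) (m : ℕ) (t : E) :
    charFun (P.map fun ω => τ • ∑ k ∈ Finset.range m, X k ω) t =
      (∫ ω, Complex.exp ((τ * inner ℝ (W ω) t : ℝ) * Complex.I) ∂P) ^ m := by
  have hXm : ∀ k, AEMeasurable (X k) P := fun k => (hX k).aemeasurable_fst
  have hsum : AEMeasurable (fun ω => ∑ k ∈ Finset.range m, X k ω) P :=
    Finset.aemeasurable_fun_sum _ fun k _ => hXm k
  have hW : AEMeasurable W P := (hX 0).aemeasurable_snd
  have h1 : charFun (P.map fun ω => τ • ∑ k ∈ Finset.range m, X k ω) t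
      = charFun (P.map fun ω => ∑ k ∈ Finset.range m, X k ω) (τ • t) := by
    rw [charFun_apply, charFun_apply, integral_map
      (φ := fun ω => τ • ∑ k ∈ Finset.range m, X k ω) (hsum.const_smul τ) (by fun_prop),
      integral_map hsum (by fun_prop)]
    simp [inner_smul_left, inner_smul_right]
  rw [h1, (hindep.restrict _).charFun_map_fun_finsetSum_eq_prod fun k _ => hXm k]
  simp only [Finset.prod_apply, (hX _).map_eq, Finset.prod_const, Finset.card_range]
  rw [charFun_apply, integral_map hW (by fun_prop)]
  simp [inner_smul_right]

/-- **Lyapunov's central limit theorem** for arrays with i.i.d. rows: the `n`-th row consists of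
independent copies of `W n`. The limit law enters through its characteristic function. -/
theorem tendstoInDistribution_smul_sum [IsProbabilityMeasure P] {X : ℕ → ℕ → Ω → E} {W : ℕ → Ω → E}
    (hX : ∀ n k, IdentDistrib (X n k) (W n) P P) (hindep : ∀ n, iIndepFun (X n) P)
    {m : ℕ → ℕ} (hm : Tendsto m atTop atTop) {τ : ℕ → ℝ}
    (hτ : Tendsto (fun n => (m n : ℝ) * τ n ^ 2) atTop (𝓝 1))
    (hW0 : ∀ n, ∫ ω, W n ω ∂P = 0) {δ : ℝ} (hδ : 0 < δ) {C : ℝ≥0}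
    (hWδ : ∀ n, ∫⁻ ω, ‖W n ω‖ₑ ^ (2 + δ) ∂P ≤ C) {Q : E → ℝ}
    (hWQ : ∀ t, Tendsto (fun n => ∫ ω, inner ℝ (W n ω) t ^ 2 ∂P) atTop (𝓝 (Q t)))
    {μ : Measure E} [IsProbabilityMeasure μ]
    (hμ : ∀ t, charFun μ t = Complex.exp (-(Q t : ℂ) / 2)) :
    TendstoInDistribution (fun n ω => τ n • ∑ k ∈ Finset.range (m n), X n k ω) atTop id
      (fun _ => P) μ := by
  have hXm : ∀ n k, AEMeasurable (X n k) P := fun n k => (hX n k).aemeasurable_fst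
  have hWm : ∀ n, AEMeasurable (W n) P := fun n => (hX n 0).aemeasurable_snd
  have hsum : ∀ n, AEMeasurable (fun ω => τ n • ∑ k ∈ Finset.range (m n), X n k ω) P := fun n =>
    (Finset.aemeasurable_fun_sum _ fun k _ => hXm n k).const_smul (τ n)
  refine ⟨hsum, aemeasurable_id, ?_⟩
  refine ProbabilityMeasure.tendsto_iff_tendsto_charFun.2 fun t => ?_
  simp only [ProbabilityMeasure.coe_mk, Measure.map_id, hμ, charFun_map_smul_sum (hX _) (hindep _)]
  -- lowering the exponent, so that the Taylor remainder of order three is controlled by it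
  set η := min δ 1
  have hη0 : 0 < η := lt_min hδ one_pos
  have hη1 : η ≤ 1 := min_le_right _ _
  have hWη : ∀ n, ∫⁻ ω, ‖W n ω‖ₑ ^ (2 + η) ∂P ≤ (1 + C : ℝ≥0) := fun n => by
    calc ∫⁻ ω, ‖W n ω‖ₑ ^ (2 + η) ∂P ≤ ∫⁻ ω, (1 + ‖W n ω‖ₑ ^ (2 + δ)) ∂P := by
          gcongr with ω
          rcases le_total ‖W n ω‖ₑ 1 with h | h
          · exact (ENNReal.rpow_le_one h (by linarith)).trans le_self_add
          · exact (ENNReal.rpow_le_rpow_of_exponent_le h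
              (by linarith [min_le_left δ 1])).trans le_add_self
      _ ≤ _ := by
          rw [lintegral_add_left measurable_const]
          simpa using hWδ n
  have hnorm : ∀ n ω, ‖W n ω‖ₑ ^ (2 + η) = ENNReal.ofReal (‖W n ω‖ ^ (2 + η)) := fun n ω => by
    rw [← ofReal_norm, ENNReal.ofReal_rpow_of_nonneg (norm_nonneg _) (by linarith)]
  have hWmη : ∀ n, AEMeasurable (fun ω => ‖W n ω‖ ^ (2 + η)) P := fun n =>
    (hWm n).norm.pow_const _
  have hWint : ∀ n, Integrable (fun ω => ‖W n ω‖ ^ (2 + η)) P := fun n => by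
    refine ⟨(hWmη n).aestronglyMeasurable, ?_⟩
    rw [hasFiniteIntegral_iff_ofReal (Eventually.of_forall fun ω => by positivity)]
    simp_rw [← hnorm]
    exact (hWη n).trans_lt ENNReal.coe_lt_top
  have hWle : ∀ n, ∫ ω, ‖W n ω‖ ^ (2 + η) ∂P ≤ 1 + C := fun n => by
    rw [integral_eq_lintegral_of_nonneg_ae (Eventually.of_forall fun ω => by positivity)
      (hWmη n).aestronglyMeasurable]
    simp_rw [← hnorm]
    exact ENNReal.toReal_le_of_le_ofReal (by positivity)
      ((hWη n).trans (by simp [ENNReal.ofReal_add]))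
  have hpw : ∀ n ω, |inner ℝ (W n ω) t| ^ (2 + η)
      ≤ ‖t‖ ^ (2 + η) * ‖W n ω‖ ^ (2 + η) := fun n ω => by
    rw [← Real.mul_rpow (norm_nonneg _) (norm_nonneg _), mul_comm]
    gcongr
    exact abs_real_inner_le_norm _ _
  have hinn : ∀ n, AEMeasurable (fun ω => inner ℝ (W n ω) t) P := fun n =>
    (hWm n).inner aemeasurable_const
  have hXint : ∀ n, Integrable (fun ω => |inner ℝ (W n ω) t| ^ (2 + η)) P := fun n => by
    refine ((hWint n).const_mul (‖t‖ ^ (2 + η))).mono'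
      ((hinn n).abs.pow_const _).aestronglyMeasurable (Eventually.of_forall fun ω => ?_)
    rw [Real.norm_of_nonneg (by positivity)]
    exact hpw n ω
  have hXle : ∀ n, ∫ ω, |inner ℝ (W n ω) t| ^ (2 + η) ∂P ≤ ‖t‖ ^ (2 + η) * (1 + C) := fun n => by
    calc _ ≤ ∫ ω, ‖t‖ ^ (2 + η) * ‖W n ω‖ ^ (2 + η) ∂P :=
          integral_mono (hXint n) ((hWint n).const_mul _) (hpw n)
      _ ≤ _ := by rw [integral_const_mul]; gcongr; exact hWle n
  have hWi : ∀ n, Integrable (W n) P := fun n => by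
    refine ((integrable_const (1 : ℝ)).add (hWint n)).mono' (hWm n).aestronglyMeasurable
      (Eventually.of_forall fun ω => ?_)
    simp only [Pi.add_apply]
    rcases le_total ‖W n ω‖ 1 with h | h
    · have : 0 ≤ ‖W n ω‖ ^ (2 + η) := by positivity
      linarith
    · have : ‖W n ω‖ ^ (1 : ℝ) ≤ ‖W n ω‖ ^ (2 + η) :=
        Real.rpow_le_rpow_of_exponent_le h (by linarith)
      rw [Real.rpow_one] at this
      linarith
  have hcent : ∀ n, ∫ ω, inner ℝ (W n ω) t ∂P = 0 := fun n => by
    simp_rw [real_inner_comm t]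
    rw [integral_inner (hWi n), hW0, inner_zero_right]
  set φ : ℕ → ℂ := fun n => ∫ ω, Complex.exp ((τ n * inner ℝ (W n ω) t : ℝ) * Complex.I) ∂P
  have hφ : ∀ n, ‖φ n - (1 - ((τ n ^ 2 * ∫ ω, inner ℝ (W n ω) t ^ 2 ∂P : ℝ) : ℂ) / 2)‖
      ≤ 4 * (|τ n| ^ (2 + η) * (‖t‖ ^ (2 + η) * (1 + C))) := fun n =>
    (norm_integral_exp_sub_le (hinn n) hη0.le hη1 (hXint n) (hcent n) (τ n)).trans
      (by gcongr; exact hXle n)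
  have hτ0 : Tendsto τ atTop (𝓝 0) := by
    have h1 : Tendsto (fun n => τ n ^ 2) atTop (𝓝 0) := by
      have := hτ.mul ((tendsto_inv_atTop_nhds_zero_nat (𝕜 := ℝ)).comp hm)
      rw [mul_zero] at this
      refine this.congr' ?_
      filter_upwards [hm.eventually_ge_atTop 1] with n hn
      have : (m n : ℝ) ≠ 0 := by exact_mod_cast (by omega : m n ≠ 0)
      simp only [Function.comp]
      field_simp
    rw [tendsto_zero_iff_abs_tendsto_zero]
    simpa [Function.comp_def, Real.sqrt_sq_eq_abs] using h1.sqrt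
  have hrem : Tendsto (fun n => (m n : ℝ) * (4 * (|τ n| ^ (2 + η) * (‖t‖ ^ (2 + η) * (1 + C)))))
      atTop (𝓝 0) := by
    have h1 : Tendsto (fun n => |τ n| ^ η) atTop (𝓝 0) := by
      have := (tendsto_zero_iff_abs_tendsto_zero _).1 hτ0
      simpa [hη0.ne'] using this.rpow_const (p := η) (Or.inr hη0.le)
    have h2 := (hτ.mul h1).mul_const (4 * (‖t‖ ^ (2 + η) * (1 + C)))
    simp only [mul_zero, zero_mul] at h2
    refine h2.congr fun n => ?_
    have : |τ n| ^ (2 + η) = τ n ^ 2 * |τ n| ^ η := by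
      rw [Real.rpow_add_of_nonneg (abs_nonneg _) (by norm_num) hη0.le, Real.rpow_two, sq_abs]
    rw [this]
    ring
  have hlim : Tendsto (fun n => (m n : ℂ) * (φ n - 1)) atTop (𝓝 (-(Q t : ℂ) / 2)) := by
    have h1 : Tendsto (fun n => (m n : ℂ) * (φ n -
        (1 - ((τ n ^ 2 * ∫ ω, inner ℝ (W n ω) t ^ 2 ∂P : ℝ) : ℂ) / 2))) atTop (𝓝 0) := by
      refine squeeze_zero_norm (fun n => ?_) hrem
      rw [norm_mul, Complex.norm_natCast]
      gcongr
      exact hφ n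
    have h2 : Tendsto (fun n => (((m n : ℝ) * τ n ^ 2 * ∫ ω, inner ℝ (W n ω) t ^ 2 ∂P : ℝ) : ℂ) / 2)
        atTop (𝓝 ((Q t : ℂ) / 2)) := by
      have := hτ.mul (hWQ t)
      rw [one_mul] at this
      exact ((Complex.continuous_ofReal.tendsto _).comp this).div_const 2
    have h3 := h1.sub h2
    rw [zero_sub, ← neg_div] at h3
    refine h3.congr fun n => ?_
    push_cast
    ring
  simpa [φ] using tendsto_one_add_pow_exp hm hlim

end CentralLimit

/-! ### Integration of a function of two independent variables -/

section Freezing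

variable {Ω : Type*} [MeasurableSpace Ω] {P : Measure Ω} [IsProbabilityMeasure P]
  {A Z : Type*} [MeasurableSpace A] [MeasurableSpace Z]
  {E : Type*} [NormedAddCommGroup E] [InnerProductSpace ℝ E] [FiniteDimensional ℝ E]
  [MeasurableSpace E] [BorelSpace E]
  {X : Ω → A} {Y V : Ω → Z}

lemma map_prodMk_eq (hX : Measurable X) (hYV : IdentDistrib Y V P P) (hXY : IndepFun X Y P) :
    P.map (fun ω => (X ω, Y ω)) = (P.map X).prod (P.map V) := by
  rw [(indepFun_iff_map_prod_eq_prod_map_map hX.aemeasurable hYV.aemeasurable_fst).1 hXY,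
    hYV.map_eq]

/-- Given `X`, the conditional law of `Y` is the law of its copy `V`. -/
lemma lintegral_freeze (hX : Measurable X) (hY : Measurable Y) (hV : Measurable V)
    (hYV : IdentDistrib Y V P P) (hXY : IndepFun X Y P) {F : A × Z → ℝ≥0∞} (hF : Measurable F) :
    ∫⁻ ω, F (X ω, Y ω) ∂P = ∫⁻ ω, ∫⁻ ω', F (X ω, V ω') ∂P ∂P := by
  have : IsProbabilityMeasure (P.map V) := Measure.isProbabilityMeasure_map hV.aemeasurable
  rw [← lintegral_map (f := F) (g := fun ω => (X ω, Y ω)) hF (hX.prodMk hY),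
    map_prodMk_eq hX hYV hXY, lintegral_prod _ hF.aemeasurable, lintegral_map _ hX]
  · congr with ω
    rw [lintegral_map _ hV]
    exact hF.comp (by fun_prop)
  · exact hF.lintegral_prod_right'

lemma integral_inner_freeze (hX : Measurable X) (hY : Measurable Y) (hV : Measurable V)
    (hYV : IdentDistrib Y V P P) (hXY : IndepFun X Y P) {K : A × Z → E} (hK : Measurable K)
    (hKi : ∀ a, Integrable (fun ω => K (a, V ω)) P) {g : A → E} (hg : Measurable g)
    (hint : Integrable (fun ω => inner ℝ (g (X ω)) (K (X ω, Y ω))) P) :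
    Integrable (fun ω => inner ℝ (g (X ω)) (∫ ω', K (X ω, V ω') ∂P)) P ∧
    ∫ ω, inner ℝ (g (X ω)) (K (X ω, Y ω)) ∂P
      = ∫ ω, inner ℝ (g (X ω)) (∫ ω', K (X ω, V ω') ∂P) ∂P := by
  have : IsProbabilityMeasure (P.map V) := Measure.isProbabilityMeasure_map hV.aemeasurable
  have hFm : Measurable fun p : A × Z => (inner ℝ (g p.1) (K p) : ℝ) :=
    (hg.comp measurable_fst).inner hK
  have hXYm : Measurable fun ω => (X ω, Y ω) := hX.prodMk hY
  have hF : Integrable (fun p : A × Z => (inner ℝ (g p.1) (K p) : ℝ)) (P.map fun ω => (X ω, Y ω)) :=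
    (integrable_map_measure hFm.aestronglyMeasurable hXYm.aemeasurable).2 hint
  have h1 : ∫ ω, inner ℝ (g (X ω)) (K (X ω, Y ω)) ∂P
      = ∫ p, (inner ℝ (g p.1) (K p) : ℝ) ∂(P.map fun ω => (X ω, Y ω)) :=
    (integral_map hXYm.aemeasurable hFm.aestronglyMeasurable).symm
  have h2 : ∀ a, ∫ z, (inner ℝ (g a) (K (a, z)) : ℝ) ∂(P.map V)
      = inner ℝ (g a) (∫ ω', K (a, V ω') ∂P) := fun a =>
    (integral_map (f := fun z => (inner ℝ (g a) (K (a, z)) : ℝ)) hV.aemeasurable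
      (hFm.comp (by fun_prop : Measurable fun z : Z => (a, z))).aestronglyMeasurable).trans
      (integral_inner (hKi a) _)
  rw [h1]
  rw [map_prodMk_eq hX hYV hXY] at hF ⊢
  rw [integral_prod _ hF, integral_map hX.aemeasurable hF.1.integral_prod_right']
  refine ⟨?_, by simp only [h2]⟩
  simpa only [Function.comp_def, h2] using hF.integral_prod_left.comp_measurable hX

lemma integrable_inner_of_memLp {μ : Measure Ω} {F : Type*} [NormedAddCommGroup F]
    [InnerProductSpace ℝ F] {f g : Ω → F} (hf : MemLp f 2 μ) (hg : MemLp g 2 μ) :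
    Integrable (fun ω => inner ℝ (f ω) (g ω)) μ := by
  refine (hf.norm.integrable_mul hg.norm).mono' (hf.1.inner hg.1) (Eventually.of_forall fun ω => ?_)
  exact norm_inner_le_norm _ _

lemma lintegral_enorm_sq {F : Type*} [NormedAddCommGroup F] {f : Ω → F} (hf : MemLp f 2 P) :
    ∫⁻ ω, ‖f ω‖ₑ ^ (2 : ℝ) ∂P = ENNReal.ofReal (∫ ω, ‖f ω‖ ^ 2 ∂P) := by
  rw [ofReal_integral_eq_lintegral_ofReal hf.integrable_norm_pow'
    (Eventually.of_forall fun ω => by positivity)]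
  congr with ω
  rw [ENNReal.rpow_two, ← ofReal_norm, ENNReal.ofReal_pow (norm_nonneg _)]

lemma memLp_two_of_lintegral_le {μ : Measure Ω} {f : Ω → E} (hf : AEMeasurable f μ) {C : ℝ}
    (h : ∫⁻ ω, ‖f ω‖ₑ ^ (2 : ℝ) ∂μ ≤ ENNReal.ofReal C) : MemLp f 2 μ := by
  refine ⟨hf.aestronglyMeasurable, ?_⟩
  rw [eLpNorm_lt_top_iff_lintegral_rpow_enorm_lt_top (by norm_num) (by norm_num)]
  simpa using h.trans_lt ENNReal.ofReal_lt_top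

lemma integral_norm_sq_le_of_lintegral_le {f : Ω → E} (hf : AEMeasurable f P) {C : ℝ} (hC : 0 ≤ C)
    (h : ∫⁻ ω, ‖f ω‖ₑ ^ (2 : ℝ) ∂P ≤ ENNReal.ofReal C) : ∫ ω, ‖f ω‖ ^ 2 ∂P ≤ C := by
  rw [lintegral_enorm_sq (memLp_two_of_lintegral_le hf h)] at h
  exact (ENNReal.ofReal_le_ofReal_iff hC).1 h

/-- Bound on the second moment of `K(X, Y)` by conditioning on `X`. -/
lemma memLp_freeze (hX : Measurable X) (hY : Measurable Y) (hV : Measurable V)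
    (hYV : IdentDistrib Y V P P) (hXY : IndepFun X Y P) {K : A × Z → E} (hK : Measurable K)
    {b : A → ℝ} (hb : ∀ a, 0 ≤ b a)
    (hKb : ∀ a, ∫⁻ ω, ‖K (a, V ω)‖ₑ ^ (2 : ℝ) ∂P ≤ ENNReal.ofReal (b a))
    (hint : Integrable (fun ω => b (X ω)) P) :
    MemLp (fun ω => K (X ω, Y ω)) 2 P ∧ ∫ ω, ‖K (X ω, Y ω)‖ ^ 2 ∂P ≤ ∫ ω, b (X ω) ∂P := by
  have h : ∫⁻ ω, ‖K (X ω, Y ω)‖ₑ ^ (2 : ℝ) ∂P ≤ ENNReal.ofReal (∫ ω, b (X ω) ∂P) := by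
    rw [lintegral_freeze hX hY hV hYV hXY (F := fun p => ‖K p‖ₑ ^ (2 : ℝ))
      (hK.enorm.pow_const _),
      ofReal_integral_eq_lintegral_ofReal hint (Eventually.of_forall fun ω => hb _)]
    exact lintegral_mono fun ω => hKb (X ω)
  have hm : AEMeasurable (fun ω => K (X ω, Y ω)) P := (hK.comp (hX.prodMk hY)).aemeasurable
  exact ⟨memLp_two_of_lintegral_le hm h,
    integral_norm_sq_le_of_lintegral_le hm (integral_nonneg fun ω => hb _) h⟩

/-- Centring decreases the second moment. -/
lemma lintegral_sub_integral_sq_le {F : Type*} [NormedAddCommGroup F] [InnerProductSpace ℝ F]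
    [CompleteSpace F] {f : Ω → F} (hf : MemLp f 2 P) :
    ∫⁻ ω, ‖f ω - ∫ ω', f ω' ∂P‖ₑ ^ (2 : ℝ) ∂P ≤ ∫⁻ ω, ‖f ω‖ₑ ^ (2 : ℝ) ∂P := by
  set v := ∫ ω', f ω' ∂P
  have hfi : Integrable f P := hf.integrable (by norm_num)
  have hinn : Integrable (fun ω => 2 * inner ℝ v (f ω)) P := (hfi.const_inner v).const_mul 2
  have hsq : Integrable (fun ω => ‖f ω‖ ^ 2) P := hf.integrable_norm_pow'
  rw [lintegral_enorm_sq (f := fun ω => f ω - v) (hf.sub (memLp_const v)), lintegral_enorm_sq hf]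
  refine ENNReal.ofReal_le_ofReal ?_
  have h1 : ∀ ω, ‖f ω - v‖ ^ 2 = ‖f ω‖ ^ 2 - 2 * inner ℝ v (f ω) + ‖v‖ ^ 2 := fun ω => by
    rw [norm_sub_sq_real, real_inner_comm]
  simp_rw [h1]
  rw [integral_add (f := fun ω => ‖f ω‖ ^ 2 - 2 * inner ℝ v (f ω)) (hsq.sub hinn)
    (integrable_const _), integral_sub hsq hinn, integral_const_mul, integral_inner hfi,
    real_inner_self_eq_norm_sq]
  simp
  nlinarith [sq_nonneg ‖v‖]

lemma integral_norm_le_sqrt {F : Type*} [NormedAddCommGroup F] {f : Ω → F} (hf : MemLp f 2 P) :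
    ∫ ω, ‖f ω‖ ∂P ≤ √(∫ ω, ‖f ω‖ ^ 2 ∂P) := by
  refine Real.le_sqrt_of_sq_le ?_
  have h := variance_nonneg (fun ω => ‖f ω‖) P
  rw [variance_eq_sub hf.norm] at h
  simpa using h

lemma integral_rpow_le {F : Type*} [NormedAddCommGroup F] {f : Ω → F} (hf : MemLp f 2 P) {b : ℝ}
    (hb0 : 0 ≤ b) (hb1 : b ≤ 1) :
    Integrable (fun ω => ‖f ω‖ ^ (2 * b)) P ∧
      ∫ ω, ‖f ω‖ ^ (2 * b) ∂P ≤ (∫ ω, ‖f ω‖ ^ 2 ∂P) ^ b := by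
  have hsq : Integrable (fun ω => ‖f ω‖ ^ 2) P := hf.integrable_norm_pow'
  have heq : ∀ ω, ‖f ω‖ ^ (2 * b) = (‖f ω‖ ^ 2) ^ b := fun ω => by
    rw [Real.rpow_mul (norm_nonneg _), Real.rpow_two]
  have hint : Integrable (fun ω => (‖f ω‖ ^ 2) ^ b) P := by
    refine ((integrable_const (1 : ℝ)).add hsq).mono'
      (hsq.aemeasurable.pow_const b).aestronglyMeasurable (Eventually.of_forall fun ω => ?_)
    rw [Real.norm_of_nonneg (by positivity)]
    simp only [Pi.add_apply]
    have h0 : 0 ≤ ‖f ω‖ ^ 2 := by positivity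
    rcases le_total (‖f ω‖ ^ 2) 1 with h | h
    · linarith [Real.rpow_le_one h0 h hb0]
    · have := Real.rpow_le_rpow_of_exponent_le h hb1
      rw [Real.rpow_one] at this
      linarith
  simp_rw [heq]
  exact ⟨hint, (Real.concaveOn_rpow hb0 hb1).le_map_integral
    (Real.continuous_rpow_const hb0).continuousOn isClosed_Ici
    (Eventually.of_forall fun ω => Set.mem_Ici.2 (by positivity)) hsq hint⟩

/-- If `x` is independent of the pair `(w, y)` and `w` of `y`, then `(x, w)` is independent
of `y`. -/
lemma indepFun_prodMk_left {B : Type*} [MeasurableSpace B] {x : Ω → A} {w : Ω → B} {y : Ω → Z}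
    (hx : Measurable x) (hw : Measurable w) (hy : Measurable y)
    (h1 : IndepFun x (fun ω => (w ω, y ω)) P) (h2 : IndepFun w y P) :
    IndepFun (fun ω => (x ω, w ω)) y P := by
  have := Measure.isProbabilityMeasure_map (μ := P) hx.aemeasurable
  have := Measure.isProbabilityMeasure_map (μ := P) hy.aemeasurable
  have := Measure.isProbabilityMeasure_map (μ := P) hw.aemeasurable
  rw [indepFun_iff_map_prod_eq_prod_map_map (by fun_prop) (by fun_prop)] at h1 h2 ⊢
  have h3 : IndepFun x w P := by
    have h1' := (indepFun_iff_map_prod_eq_prod_map_map (by fun_prop) (by fun_prop)).2 h1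
    exact h1'.comp measurable_id measurable_fst
  rw [indepFun_iff_map_prod_eq_prod_map_map (by fun_prop) (by fun_prop)] at h3
  rw [h3]
  apply (MeasurableEquiv.map_measurableEquiv_injective MeasurableEquiv.prodAssoc)
  rw [Measure.prodAssoc_prod, ← h2, ← h1, Measure.map_map (by fun_prop) (by fun_prop)]
  rfl

end Freezing

/-! ### One run of the scheme -/

section Scheme

variable {d q : ℕ} {H : Vec d → Vec q → Vec d} {γ : ℝ → ℝ}

lemma schemeIter_congr (x₀ : Vec d) {u v : ℕ → Vec q} {k : ℕ} (huv : ∀ p < k, u p = v p) :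
    schemeIter H γ x₀ u k = schemeIter H γ x₀ v k := by
  induction k with
  | zero => rfl
  | succ k ih =>
    simp only [schemeIter]
    rw [ih fun p hp => huv p (hp.trans (Nat.lt_succ_self k)), huv k (Nat.lt_succ_self k)]

lemma measurable_schemeIter (hH : Measurable (Function.uncurry H)) (k : ℕ) :
    Measurable fun a : Vec d × (ℕ → Vec q) => schemeIter H γ a.1 a.2 k := by
  induction k with
  | zero => exact measurable_fst
  | succ k ih =>
    simp only [schemeIter]
    have h : Measurable fun a : Vec d × (ℕ → Vec q) => H (schemeIter H γ a.1 a.2 k) (a.2 k) :=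
      hH.comp (ih.prodMk ((measurable_pi_apply k).comp measurable_snd))
    exact ih.sub (h.const_smul (γ ((k : ℝ) + 1)))

/-- The initial value and the first `m` innovations, the later ones being replaced by `0`. -/
def past {Ω : Type*} (x₀ : Ω → Vec d) (u : ℕ → Ω → Vec q) (m : ℕ) (ω : Ω) : Vec d × (ℕ → Vec q) :=
  (x₀ ω, fun p => if p < m then u p ω else 0)

/-- The scheme as a process on the probability space. -/
def process {Ω : Type*} (H : Vec d → Vec q → Vec d) (γ : ℝ → ℝ) (x₀ : Ω → Vec d)
    (u : ℕ → Ω → Vec q) (k : ℕ) (ω : Ω) : Vec d :=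
  schemeIter H γ (x₀ ω) (fun p => u p ω) k

lemma process_succ {Ω : Type*} (x₀ : Ω → Vec d) (u : ℕ → Ω → Vec q) (k : ℕ) (ω : Ω) :
    process H γ x₀ u (k + 1) ω = process H γ x₀ u k ω
      - γ ((k : ℝ) + 1) • H (process H γ x₀ u k ω) (u k ω) := rfl

/-- The iterate `θ_k` is a measurable function of the past at any time `m ≥ k`. -/
lemma exists_past_eq {Ω : Type*} (hH : Measurable (Function.uncurry H)) (x₀ : Ω → Vec d)
    (u : ℕ → Ω → Vec q) (k : ℕ) :
    ∃ S : Vec d × (ℕ → Vec q) → Vec d, Measurable S ∧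
      ∀ m, k ≤ m → ∀ ω, S (past x₀ u m ω) = process H γ x₀ u k ω :=
  ⟨fun a => schemeIter H γ a.1 a.2 k, measurable_schemeIter hH k, fun m hkm ω =>
    schemeIter_congr _ fun p hp => by simp [past, hp.trans_le hkm]⟩

/-- The part of the martingale increment that vanishes at the zero `c`. It has conditional mean
zero and, by the Hölder condition, a small second moment near `c`. -/
def remainder (H : Vec d → Vec q → Vec d) (f : Vec d → Vec d) (c θ : Vec d) (z : Vec q) : Vec d :=
  H θ z - H c z - f θ

/-- The data of one run of the scheme: the law of `V` is that of the innovations `u p`, `f` is the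
mean field, `c` its zero, and `C`, `b`, `lam` and `L` are constants that will not depend on the
run. The linear map `B` is the derivative of `f` at `c`, which enters only through
`taylor`. -/
structure IsRun {Ω : Type*} [MeasurableSpace Ω] (P : Measure Ω) (H : Vec d → Vec q → Vec d)
    (f : Vec d → Vec d) (c : Vec d) (B : Vec d →L[ℝ] Vec d) (V : Ω → Vec q) (u : ℕ → Ω → Vec q)
    (x₀ : Ω → Vec d) (C b lam L : ℝ) : Prop where
  measurable_H : Measurable (Function.uncurry H)
  measurable_V : Measurable V
  measurable_u : ∀ p, Measurable (u p)
  measurable_init : Measurable x₀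
  identDistrib : ∀ p, IdentDistrib (u p) V P P
  iIndepFun : iIndepFun u P
  indepFun : IndepFun x₀ (fun ω p => u p ω) P
  mean : ∀ θ, ∫ ω, H θ (V ω) ∂P = f θ
  continuous : Continuous f
  zero : f c = 0
  C_nonneg : 0 ≤ C
  b_nonneg : 0 ≤ b
  b_le : b ≤ 1
  L_nonneg : 0 ≤ L
  holder : ∀ θ θ', ∫⁻ ω, ‖H θ (V ω) - H θ' (V ω)‖ₑ ^ (2 : ℝ) ∂P
    ≤ ENNReal.ofReal (C * ‖θ - θ'‖ ^ (2 * b))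
  sq_le : ∫⁻ ω, ‖H c (V ω)‖ₑ ^ (2 : ℝ) ∂P ≤ ENNReal.ofReal C
  init_le : ∫⁻ ω, ‖x₀ ω - c‖ₑ ^ (2 : ℝ) ∂P ≤ ENNReal.ofReal C
  le_inner : ∀ θ, lam * ‖θ - c‖ ^ 2 ≤ inner ℝ (θ - c) (f θ)
  taylor : ∀ θ, ‖f θ - B (θ - c)‖ ≤ L * ‖θ - c‖ ^ 2

namespace IsRun

variable {Ω : Type*} [MeasurableSpace Ω] {P : Measure Ω}
  {f : Vec d → Vec d} {c : Vec d} {B : Vec d →L[ℝ] Vec d} {V : Ω → Vec q} {u : ℕ → Ω → Vec q}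
  {x₀ : Ω → Vec d} {C b lam L : ℝ}

lemma measurable_past (hr : IsRun P H f c B V u x₀ C b lam L) (m : ℕ) :
    Measurable (past x₀ u m) := by
  refine hr.measurable_init.prodMk (measurable_pi_lambda _ fun p => ?_)
  split_ifs
  · exact hr.measurable_u p
  · exact measurable_const

variable [IsProbabilityMeasure P] in
lemma indepFun_past (hr : IsRun P H f c B V u x₀ C b lam L) (m : ℕ) :
    IndepFun (past x₀ u m) (u m) P := by
  have hw : Measurable fun v : ℕ → Vec q => fun p => if p < m then v p else 0 := by
    refine measurable_pi_lambda _ fun p => ?_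
    split_ifs
    · exact measurable_pi_apply p
    · exact measurable_const
  have hu : Measurable fun ω p => u p ω := measurable_pi_lambda _ hr.measurable_u
  refine indepFun_prodMk_left (w := fun ω p => if p < m then u p ω else 0) hr.measurable_init
    (hw.comp hu) (hr.measurable_u m) ?_ ?_
  · exact hr.indepFun.comp measurable_id (hw.prodMk (measurable_pi_apply m))
  · have h := hr.iIndepFun.indepFun_finset (Finset.range m) {m} (by simp) hr.measurable_u
    let φ : (Finset.range m → Vec q) → ℕ → Vec q := fun v p =>
      if hp : p < m then v ⟨p, Finset.mem_range.2 hp⟩ else 0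
    have hφ : Measurable φ := by
      refine measurable_pi_lambda _ fun p => ?_
      by_cases hp : p < m
      · simp only [φ, hp, dif_pos]
        exact measurable_pi_apply _
      · simp only [φ, hp, dif_neg, not_false_eq_true]
        exact measurable_const
    have h2 := h.comp hφ (measurable_pi_apply ⟨m, Finset.mem_singleton_self m⟩)
    convert! h2 using 1

lemma measurable_process (hr : IsRun P H f c B V u x₀ C b lam L) (k : ℕ) :
    Measurable (process H γ x₀ u k) :=
  (measurable_schemeIter hr.measurable_H k).comp
    (hr.measurable_init.prodMk (measurable_pi_lambda _ hr.measurable_u))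

lemma measurable_apply (hr : IsRun P H f c B V u x₀ C b lam L) (θ : Vec d) {W : Ω → Vec q}
    (hW : Measurable W) : Measurable fun ω => H θ (W ω) :=
  hr.measurable_H.comp (measurable_const.prodMk hW)

lemma lintegral_sq_le (hr : IsRun P H f c B V u x₀ C b lam L) (θ : Vec d) :
    ∫⁻ ω, ‖H θ (V ω)‖ₑ ^ (2 : ℝ) ∂P ≤ ENNReal.ofReal (4 * C * (1 + ‖θ - c‖ ^ 2)) := by
  have hC := hr.C_nonneg
  have hm : Measurable fun ω => ‖H θ (V ω) - H c (V ω)‖ₑ ^ (2 : ℝ) :=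
    ((hr.measurable_apply θ hr.measurable_V).sub
      (hr.measurable_apply c hr.measurable_V)).enorm.pow_const _
  have h1 : ‖θ - c‖ ^ (2 * b) ≤ 1 + ‖θ - c‖ ^ 2 := by
    rcases le_total ‖θ - c‖ 1 with h | h
    · have := Real.rpow_le_one (norm_nonneg (θ - c)) h (by linarith [hr.b_nonneg] : 0 ≤ 2 * b)
      nlinarith [sq_nonneg ‖θ - c‖]
    · have := Real.rpow_le_rpow_of_exponent_le h (by linarith [hr.b_le] : 2 * b ≤ 2)
      rw [Real.rpow_two] at this
      linarith
  calc ∫⁻ ω, ‖H θ (V ω)‖ₑ ^ (2 : ℝ) ∂P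
      ≤ ∫⁻ ω, 2 * (‖H θ (V ω) - H c (V ω)‖ₑ ^ (2 : ℝ) + ‖H c (V ω)‖ₑ ^ (2 : ℝ)) ∂P := by
        refine lintegral_mono fun ω => ?_
        have h2 : ‖H θ (V ω)‖ₑ ≤ ‖H θ (V ω) - H c (V ω)‖ₑ + ‖H c (V ω)‖ₑ := by
          simpa using enorm_add_le (H θ (V ω) - H c (V ω)) (H c (V ω))
        refine (ENNReal.rpow_le_rpow h2 (by norm_num)).trans ?_
        refine (ENNReal.rpow_add_le_mul_rpow_add_rpow _ _ (by norm_num : (1 : ℝ) ≤ 2)).trans_eq ?_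
        norm_num
    _ = 2 * (∫⁻ ω, ‖H θ (V ω) - H c (V ω)‖ₑ ^ (2 : ℝ) ∂P + ∫⁻ ω, ‖H c (V ω)‖ₑ ^ (2 : ℝ) ∂P) := by
        rw [lintegral_const_mul' _ _ (by norm_num), lintegral_add_left hm]
    _ ≤ ENNReal.ofReal 2 * (ENNReal.ofReal (C * ‖θ - c‖ ^ (2 * b)) + ENNReal.ofReal C) := by
        rw [ENNReal.ofReal_ofNat]
        gcongr
        · exact hr.holder θ c
        · exact hr.sq_le
    _ = ENNReal.ofReal (2 * (C * ‖θ - c‖ ^ (2 * b) + C)) := by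
        rw [← ENNReal.ofReal_add (by positivity) hC, ENNReal.ofReal_mul (by norm_num)]
    _ ≤ _ := ENNReal.ofReal_le_ofReal (by nlinarith [sq_nonneg ‖θ - c‖])

lemma memLp_apply (hr : IsRun P H f c B V u x₀ C b lam L) (θ : Vec d) :
    MemLp (fun ω => H θ (V ω)) 2 P :=
  memLp_two_of_lintegral_le (hr.measurable_apply θ hr.measurable_V).aemeasurable
    (hr.lintegral_sq_le θ)

lemma memLp_init (hr : IsRun P H f c B V u x₀ C b lam L) : MemLp (fun ω => x₀ ω - c) 2 P :=
  memLp_two_of_lintegral_le (hr.measurable_init.sub_const c).aemeasurable hr.init_le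

lemma memLp_sub (hr : IsRun P H f c B V u x₀ C b lam L) (θ : Vec d) :
    MemLp (fun ω => H θ (V ω) - H c (V ω)) 2 P :=
  (hr.memLp_apply θ).sub (hr.memLp_apply c)

lemma measurable_remainder (hr : IsRun P H f c B V u x₀ C b lam L) :
    Measurable (Function.uncurry (remainder H f c)) :=
  (hr.measurable_H.sub (hr.measurable_H.comp (measurable_const.prodMk measurable_snd))).sub
    (hr.continuous.measurable.comp measurable_fst)

variable [IsProbabilityMeasure P]

lemma memLp_comp (hr : IsRun P H f c B V u x₀ C b lam L) (k : ℕ) {K : Vec d → Vec q → Vec d}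
    (hK : Measurable (Function.uncurry K)) {β : Vec d → ℝ} (hβ : ∀ θ, 0 ≤ β θ)
    (hKβ : ∀ θ, ∫⁻ ω, ‖K θ (V ω)‖ₑ ^ (2 : ℝ) ∂P ≤ ENNReal.ofReal (β θ))
    (hint : Integrable (fun ω => β (process H γ x₀ u k ω)) P) :
    MemLp (fun ω => K (process H γ x₀ u k ω) (u k ω)) 2 P ∧
    ∫ ω, ‖K (process H γ x₀ u k ω) (u k ω)‖ ^ 2 ∂P ≤ ∫ ω, β (process H γ x₀ u k ω) ∂P := by
  obtain ⟨S, hSm, hS⟩ := exists_past_eq (γ := γ) hr.measurable_H x₀ u k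
  have h := memLp_freeze (hr.measurable_past k) (hr.measurable_u k) hr.measurable_V
    (hr.identDistrib k) (hr.indepFun_past k)
    (K := fun p => K (S p.1) p.2) (b := fun a => β (S a))
    (hK.comp ((hSm.comp measurable_fst).prodMk measurable_snd))
    (fun a => hβ (S a)) (fun a => hKβ (S a)) (by simpa only [hS k le_rfl] using hint)
  simpa only [hS k le_rfl] using h

lemma integral_inner_comp (hr : IsRun P H f c B V u x₀ C b lam L) (k : ℕ)
    {K : Vec d → Vec q → Vec d} (hK : Measurable (Function.uncurry K))
    (hKi : ∀ θ, Integrable (fun ω => K θ (V ω)) P) {g : Vec d × (ℕ → Vec q) → Vec d}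
    (hg : Measurable g)
    (hint : Integrable (fun ω => inner ℝ (g (past x₀ u k ω))
      (K (process H γ x₀ u k ω) (u k ω))) P) :
    Integrable (fun ω => inner ℝ (g (past x₀ u k ω))
      (∫ ω', K (process H γ x₀ u k ω) (V ω') ∂P)) P ∧
    ∫ ω, inner ℝ (g (past x₀ u k ω)) (K (process H γ x₀ u k ω) (u k ω)) ∂P
      = ∫ ω, inner ℝ (g (past x₀ u k ω)) (∫ ω', K (process H γ x₀ u k ω) (V ω') ∂P) ∂P := by
  obtain ⟨S, hSm, hS⟩ := exists_past_eq (γ := γ) hr.measurable_H x₀ u k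
  have h := integral_inner_freeze (hr.measurable_past k) (hr.measurable_u k) hr.measurable_V
    (hr.identDistrib k) (hr.indepFun_past k) (K := fun p => K (S p.1) p.2) (g := g)
    (hK.comp ((hSm.comp measurable_fst).prodMk measurable_snd)) (fun a => hKi (S a)) hg
    (by simpa only [hS k le_rfl] using hint)
  simpa only [hS k le_rfl] using h

/-- The innovation `H(θ_k, u_k)` is square integrable as soon as `θ_k` is. -/
lemma memLp_innovation (hr : IsRun P H f c B V u x₀ C b lam L) (k : ℕ)
    (hk : MemLp (fun ω => process H γ x₀ u k ω - c) 2 P) :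
    MemLp (fun ω => H (process H γ x₀ u k ω) (u k ω)) 2 P ∧
    ∫ ω, ‖H (process H γ x₀ u k ω) (u k ω)‖ ^ 2 ∂P
      ≤ 4 * C * (1 + ∫ ω, ‖process H γ x₀ u k ω - c‖ ^ 2 ∂P) := by
  have hC := hr.C_nonneg
  have hsq : Integrable (fun ω => ‖process H γ x₀ u k ω - c‖ ^ 2) P := hk.integrable_norm_pow'
  have h := hr.memLp_comp (γ := γ) k hr.measurable_H
    (β := fun θ => 4 * C * (1 + ‖θ - c‖ ^ 2)) (fun θ => by positivity) hr.lintegral_sq_le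
    (((integrable_const 1).add hsq).const_mul _)
  refine ⟨h.1, h.2.trans_eq ?_⟩
  rw [integral_const_mul, integral_add (integrable_const 1) hsq]
  simp

lemma memLp_process (hr : IsRun P H f c B V u x₀ C b lam L) (k : ℕ) :
    MemLp (fun ω => process H γ x₀ u k ω - c) 2 P := by
  induction k with
  | zero => exact hr.memLp_init
  | succ k ih =>
    refine (ih.sub ((hr.memLp_innovation k ih).1.const_smul (γ ((k : ℝ) + 1)))).ae_eq
      (Eventually.of_forall fun ω => ?_)
    simp only [process_succ, Pi.sub_apply, Pi.smul_apply]
    abel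

/-- The mean square distance to the zero contracts. -/
lemma integral_sq_succ_le (hr : IsRun P H f c B V u x₀ C b lam L) (k : ℕ)
    (hγ : 0 ≤ γ ((k : ℝ) + 1)) :
    ∫ ω, ‖process H γ x₀ u (k + 1) ω - c‖ ^ 2 ∂P
      ≤ (1 - 2 * lam * γ ((k : ℝ) + 1) + 4 * C * γ ((k : ℝ) + 1) ^ 2)
          * ∫ ω, ‖process H γ x₀ u k ω - c‖ ^ 2 ∂P
        + 4 * C * γ ((k : ℝ) + 1) ^ 2 := by
  set s := γ ((k : ℝ) + 1)
  have hsucc : ∀ ω, process H γ x₀ u (k + 1) ω - c = (process H γ x₀ u k ω - c)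
      - s • H (process H γ x₀ u k ω) (u k ω) := fun ω => by rw [process_succ]; abel
  have hT : MemLp (fun ω => process H γ x₀ u k ω - c) 2 P := hr.memLp_process k
  obtain ⟨hI, hIle⟩ := hr.memLp_innovation (γ := γ) k hT
  have hinn := integrable_inner_of_memLp hT hI
  obtain ⟨S, hSm, hS⟩ := exists_past_eq (γ := γ) hr.measurable_H x₀ u k
  have hfreeze := hr.integral_inner_comp (γ := γ) k hr.measurable_H
    (fun θ => (hr.memLp_apply θ).integrable (by norm_num)) (g := fun a => S a - c)
    (hSm.sub_const c) (by simpa only [hS k le_rfl] using hinn)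
  simp only [hS k le_rfl, hr.mean] at hfreeze
  set T := process H γ x₀ u k
  have hTsq : Integrable (fun ω => ‖T ω - c‖ ^ 2) P := hT.integrable_norm_pow'
  have hIsq : Integrable (fun ω => ‖H (T ω) (u k ω)‖ ^ 2) P := hI.integrable_norm_pow'
  have hlow : lam * ∫ ω, ‖T ω - c‖ ^ 2 ∂P ≤ ∫ ω, inner ℝ (T ω - c) (H (T ω) (u k ω)) ∂P := by
    rw [hfreeze.2, ← integral_const_mul]
    exact integral_mono (hTsq.const_mul lam) hfreeze.1 fun ω => hr.le_inner _
  have hexp : ∀ ω, ‖process H γ x₀ u (k + 1) ω - c‖ ^ 2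
      = ‖T ω - c‖ ^ 2 - 2 * s * inner ℝ (T ω - c) (H (T ω) (u k ω))
        + s ^ 2 * ‖H (T ω) (u k ω)‖ ^ 2 := fun ω => by
    rw [hsucc, norm_sub_sq_real, inner_smul_right, norm_smul, mul_pow, Real.norm_eq_abs, sq_abs]
    ring
  simp_rw [hexp]
  rw [integral_add (f := fun ω => ‖T ω - c‖ ^ 2 - 2 * s * inner ℝ (T ω - c) (H (T ω) (u k ω)))
    (hTsq.sub (hinn.const_mul _)) (hIsq.const_mul _), integral_sub hTsq (hinn.const_mul _),
    integral_const_mul, integral_const_mul]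
  have h1 : 2 * s * (lam * ∫ ω, ‖T ω - c‖ ^ 2 ∂P)
      ≤ 2 * s * ∫ ω, inner ℝ (T ω - c) (H (T ω) (u k ω)) ∂P := by gcongr
  have h2 : s ^ 2 * ∫ ω, ‖H (T ω) (u k ω)‖ ^ 2 ∂P
      ≤ s ^ 2 * (4 * C * (1 + ∫ ω, ‖T ω - c‖ ^ 2 ∂P)) := by gcongr
  linarith

lemma integral_sub_eq (hr : IsRun P H f c B V u x₀ C b lam L) (θ : Vec d) :
    ∫ ω, (H θ (V ω) - H c (V ω)) ∂P = f θ := by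
  rw [integral_sub ((hr.memLp_apply θ).integrable (by norm_num))
    ((hr.memLp_apply c).integrable (by norm_num)), hr.mean, hr.mean, hr.zero, sub_zero]

lemma integrable_remainder (hr : IsRun P H f c B V u x₀ C b lam L) (θ : Vec d) :
    Integrable (fun ω => remainder H f c θ (V ω)) P :=
  ((hr.memLp_sub θ).integrable (by norm_num)).sub (integrable_const _)

lemma integral_remainder (hr : IsRun P H f c B V u x₀ C b lam L) (θ : Vec d) :
    ∫ ω, remainder H f c θ (V ω) ∂P = 0 := by
  simp only [remainder]
  rw [integral_sub ((hr.memLp_sub θ).integrable (by norm_num)) (integrable_const _),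
    hr.integral_sub_eq]
  simp

lemma lintegral_remainder_le (hr : IsRun P H f c B V u x₀ C b lam L) (θ : Vec d) :
    ∫⁻ ω, ‖remainder H f c θ (V ω)‖ₑ ^ (2 : ℝ) ∂P ≤ ENNReal.ofReal (C * ‖θ - c‖ ^ (2 * b)) := by
  have h := lintegral_sub_integral_sq_le (hr.memLp_sub θ)
  rw [hr.integral_sub_eq] at h
  exact h.trans (hr.holder θ c)

lemma memLp_remainder (hr : IsRun P H f c B V u x₀ C b lam L) (k : ℕ) :
    MemLp (fun ω => remainder H f c (process H γ x₀ u k ω) (u k ω)) 2 P ∧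
    ∫ ω, ‖remainder H f c (process H γ x₀ u k ω) (u k ω)‖ ^ 2 ∂P
      ≤ C * (∫ ω, ‖process H γ x₀ u k ω - c‖ ^ 2 ∂P) ^ b := by
  have hC := hr.C_nonneg
  obtain ⟨hi, hle⟩ := integral_rpow_le (hr.memLp_process (γ := γ) k) hr.b_nonneg hr.b_le
  have h := hr.memLp_comp (γ := γ) k hr.measurable_remainder (fun θ => by positivity)
    hr.lintegral_remainder_le (hi.const_mul C)
  refine ⟨h.1, h.2.trans ?_⟩
  rw [integral_const_mul]
  gcongr

/-- The remainders are orthogonal in `L²`. -/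
lemma memLp_sum_remainder (hr : IsRun P H f c B V u x₀ C b lam L) (m : ℕ) :
    MemLp (fun ω => ∑ k ∈ Finset.range m, remainder H f c (process H γ x₀ u k ω) (u k ω)) 2 P ∧
    ∫ ω, ‖∑ k ∈ Finset.range m, remainder H f c (process H γ x₀ u k ω) (u k ω)‖ ^ 2 ∂P
      ≤ ∑ k ∈ Finset.range m, C * (∫ ω, ‖process H γ x₀ u k ω - c‖ ^ 2 ∂P) ^ b := by
  induction m with
  | zero => simp
  | succ m ih =>
    obtain ⟨hM, hMle⟩ := ih
    obtain ⟨hζ, hζle⟩ := hr.memLp_remainder (γ := γ) m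
    have hinn := integrable_inner_of_memLp hM hζ
    choose S hSm hS using fun k => exists_past_eq (γ := γ) hr.measurable_H x₀ u k
    set g : Vec d × (ℕ → Vec q) → Vec d := fun a =>
      ∑ k ∈ Finset.range m, remainder H f c (S k a) (a.2 k)
    have hgm : Measurable g := Finset.measurable_fun_sum _ fun k _ =>
      hr.measurable_remainder.comp ((hSm k).prodMk ((measurable_pi_apply k).comp measurable_snd))
    have hg : ∀ ω, g (past x₀ u m ω)
        = ∑ k ∈ Finset.range m, remainder H f c (process H γ x₀ u k ω) (u k ω) := fun ω =>
      Finset.sum_congr rfl fun k hk => by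
        have hk' := Finset.mem_range.1 hk
        rw [hS k m hk'.le]
        simp [past, hk']
    have horth := (hr.integral_inner_comp (γ := γ) m hr.measurable_remainder
      hr.integrable_remainder hgm (by simpa only [hg] using hinn)).2
    simp only [hg, hr.integral_remainder, inner_zero_right, integral_zero] at horth
    simp_rw [Finset.sum_range_succ]
    refine ⟨hM.add hζ, ?_⟩
    have hMsq : Integrable (fun ω => ‖∑ k ∈ Finset.range m,
      remainder H f c (process H γ x₀ u k ω) (u k ω)‖ ^ 2) P := hM.integrable_norm_pow'
    have hζsq : Integrable (fun ω => ‖remainder H f c (process H γ x₀ u m ω) (u m ω)‖ ^ 2) P :=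
      hζ.integrable_norm_pow'
    simp_rw [norm_add_sq_real]
    rw [integral_add (f := fun ω => ‖∑ k ∈ Finset.range m,
        remainder H f c (process H γ x₀ u k ω) (u k ω)‖ ^ 2 + 2 * inner ℝ (∑ k ∈ Finset.range m,
        remainder H f c (process H γ x₀ u k ω) (u k ω))
          (remainder H f c (process H γ x₀ u m ω) (u m ω)))
      (hMsq.add (hinn.const_mul 2)) hζsq, integral_add hMsq (hinn.const_mul 2),
      integral_const_mul, horth]
    linarith

end IsRun

end Scheme

/-! ### Averages of one run -/

/-- Summation by parts for the weighted increments of `Y`. -/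
lemma sum_smul_sub {E : Type*} [AddCommGroup E] [Module ℝ E] (w : ℕ → ℝ) (Y : ℕ → E) (m : ℕ) :
    ∑ k ∈ Finset.range m, w (k + 1) • (Y k - Y (k + 1))
      = w 0 • Y 0 - w m • Y m + ∑ k ∈ Finset.range m, (w (k + 1) - w k) • Y k := by
  induction m with
  | zero => simp
  | succ m ih =>
    rw [Finset.sum_range_succ, ih, Finset.sum_range_succ]
    module

section Scheme

variable {d q : ℕ} {H : Vec d → Vec q → Vec d} {γ : ℝ → ℝ}
  {Ω : Type*} [MeasurableSpace Ω] {P : Measure Ω}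

namespace IsRun

variable {f : Vec d → Vec d} {c : Vec d} {B : Vec d →L[ℝ] Vec d} {V : Ω → Vec q}
  {u : ℕ → Ω → Vec q} {x₀ : Ω → Vec d} {C b lam L : ℝ}

lemma memLp_linearized [IsProbabilityMeasure P] (hr : IsRun P H f c B V u x₀ C b lam L) (m : ℕ) :
    MemLp (fun ω => B (∑ k ∈ Finset.range m, (process H γ x₀ u k ω - c))
      + ∑ k ∈ Finset.range m, H c (u k ω)) 2 P := by
  refine MemLp.add ?_ ?_
  · exact B.comp_memLp' (memLp_finsetSum _ fun k _ => hr.memLp_process k)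
  · refine memLp_finsetSum _ fun k _ => ?_
    have hHc : Measurable (H c) := hr.measurable_H.comp (measurable_const.prodMk measurable_id)
    exact ((hr.identDistrib k).comp hHc).memLp_iff.2 (hr.memLp_apply c)

/-- Up to three error terms, the linearized sum of the deviations `θ_k - c` is the sum of the
independent variables `-H(c, u_k)`: this is the recursion divided by the step and summed. -/
lemma norm_linearized_le (hr : IsRun P H f c B V u x₀ C b lam L) {a : ℝ}
    (hγ : IsRegVaryingStep γ a) (m : ℕ) (ω : Ω) :
    ‖B (∑ k ∈ Finset.range m, (process H γ x₀ u k ω - c)) + ∑ k ∈ Finset.range m, H c (u k ω)‖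
      ≤ (γ 0)⁻¹ * ‖process H γ x₀ u 0 ω - c‖ + (γ m)⁻¹ * ‖process H γ x₀ u m ω - c‖
        + ∑ k ∈ Finset.range m, ((γ ((k : ℝ) + 1))⁻¹ - (γ k)⁻¹) * ‖process H γ x₀ u k ω - c‖
        + ∑ k ∈ Finset.range m, L * ‖process H γ x₀ u k ω - c‖ ^ 2
        + ‖∑ k ∈ Finset.range m, remainder H f c (process H γ x₀ u k ω) (u k ω)‖ := by
  obtain ⟨Y, hY⟩ : ∃ Y : ℕ → Vec d, ∀ k, process H γ x₀ u k ω - c = Y k := ⟨_, fun _ => rfl⟩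
  simp only [hY]
  have hstep : ∀ k, B (Y k) + H c (u k ω)
      = (γ ((k : ℝ) + 1))⁻¹ • (Y k - Y (k + 1)) - (f (process H γ x₀ u k ω) - B (Y k))
        - remainder H f c (process H γ x₀ u k ω) (u k ω) := fun k => by
    have hne : γ ((k : ℝ) + 1) ≠ 0 := (hγ.pos _ (by positivity)).ne'
    have h1 : Y k - Y (k + 1) = γ ((k : ℝ) + 1) • H (process H γ x₀ u k ω) (u k ω) := by
      rw [← hY, ← hY, process_succ]; abel
    rw [h1, smul_smul, inv_mul_cancel₀ hne, one_smul, remainder]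
    abel
  have hsum : B (∑ k ∈ Finset.range m, Y k) + ∑ k ∈ Finset.range m, H c (u k ω)
      = (γ 0)⁻¹ • Y 0 - (γ m)⁻¹ • Y m
        + ∑ k ∈ Finset.range m, ((γ ((k : ℝ) + 1))⁻¹ - (γ k)⁻¹) • Y k
        - ∑ k ∈ Finset.range m, (f (process H γ x₀ u k ω) - B (Y k))
        - ∑ k ∈ Finset.range m, remainder H f c (process H γ x₀ u k ω) (u k ω) := by
    have h2 := sum_smul_sub (fun k : ℕ => (γ k)⁻¹) Y m
    push_cast at h2
    rw [← h2, map_sum, ← Finset.sum_add_distrib, ← Finset.sum_sub_distrib,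
      ← Finset.sum_sub_distrib]
    exact Finset.sum_congr rfl fun k _ => hstep k
  rw [hsum]
  refine (norm_sub_le _ _).trans (add_le_add ((norm_sub_le _ _).trans (add_le_add
    ((norm_add_le _ _).trans (add_le_add ((norm_sub_le _ _).trans
    (add_le_add ?_ ?_)) ?_)) ?_)) le_rfl)
  · rw [norm_smul, Real.norm_of_nonneg (inv_nonneg.2 (hγ.pos 0 le_rfl).le)]
  · rw [norm_smul, Real.norm_of_nonneg (inv_nonneg.2 (hγ.pos_nat m).le)]
  · refine (norm_sum_le _ _).trans (Finset.sum_le_sum fun k _ => ?_)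
    have h3 : γ ((k : ℝ) + 1) ≤ γ k := by simpa using hγ.antitone_nat (Nat.le_succ k)
    rw [norm_smul, Real.norm_of_nonneg (sub_nonneg.2 (inv_anti₀ (hγ.pos _ (by positivity)) h3))]
  · refine (norm_sum_le _ _).trans (Finset.sum_le_sum fun k _ => ?_)
    rw [← hY]
    exact hr.taylor _

end IsRun

/-- The linearization error of the sum of `m` iterates is `o(√m)` in `L¹`, uniformly over all runs
with the same constants. -/
theorem exists_linearization_error [IsProbabilityMeasure P] {a : ℝ} (hγ : IsRegVaryingStep γ a)
    (ha : 1 / 2 < a) (ha' : a < 1) {C b lam L : ℝ} (hC : 0 ≤ C) (hb : 0 < b) (hlam : 0 < lam)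
    (hL : 0 ≤ L) :
    ∃ ρ : ℕ → ℝ, Tendsto ρ atTop (𝓝 0) ∧ ∀ (f : Vec d → Vec d) (c : Vec d) (B : Vec d →L[ℝ] Vec d)
      (V : Ω → Vec q) (u : ℕ → Ω → Vec q) (x₀ : Ω → Vec d), IsRun P H f c B V u x₀ C b lam L →
      ∀ m : ℕ, (√(m : ℝ))⁻¹ * ∫ ω, ‖B (∑ k ∈ Finset.range m, (process H γ x₀ u k ω - c))
        + ∑ k ∈ Finset.range m, H c (u k ω)‖ ∂P ≤ ρ m := by
  obtain ⟨K, hK0, hK⟩ := hγ.exists_le_mul_of_rec (by linarith) ha' hlam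
    (by positivity : 0 ≤ 4 * C) hC
  obtain ⟨R, hR1, hR⟩ := hγ.exists_ratio_le ha'
  have hγb : Tendsto (fun k : ℕ => γ k ^ b) atTop (𝓝 0) := by
    simpa [hb.ne'] using hγ.tendsto_nat.rpow_const (p := b) (Or.inr hb.le)
  refine ⟨fun m => √K * (3 + R) * ((√m)⁻¹ * (√(γ m))⁻¹)
    + L * K * ((√m)⁻¹ * ∑ k ∈ Finset.range m, γ k)
    + √(C * K ^ b * ((m : ℝ)⁻¹ * ∑ k ∈ Finset.range m, γ k ^ b)), ?_, ?_⟩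
  · have h1 := (hγ.tendsto_inv_sqrt (by linarith) ha').const_mul (√K * (3 + R))
    have h2 := (hγ.tendsto_sum ha).const_mul (L * K)
    have h3 := (hγb.cesaro.const_mul (C * K ^ b)).sqrt
    simpa using (h1.add h2).add h3
  intro f c B V u x₀ hr m
  have hD : ∀ k, ∫ ω, ‖process H γ x₀ u k ω - c‖ ^ 2 ∂P ≤ K * γ k := by
    refine hK _ (fun k => integral_nonneg fun ω => by positivity) ?_ fun k => ?_
    · exact integral_norm_sq_le_of_lintegral_le
        (hr.measurable_init.sub_const c).aemeasurable hr.C_nonneg hr.init_le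
    · exact hr.integral_sq_succ_le k (hγ.pos _ (by positivity)).le
  have hsqi : ∀ k, Integrable (fun ω => ‖process H γ x₀ u k ω - c‖ ^ 2) P := fun k =>
    (hr.memLp_process k).integrable_norm_pow'
  have hi : ∀ k, Integrable (fun ω => ‖process H γ x₀ u k ω - c‖) P := fun k =>
    ((hr.memLp_process k).integrable (by norm_num)).norm
  have hE : ∀ k, ∫ ω, ‖process H γ x₀ u k ω - c‖ ∂P ≤ √K * √(γ k) := fun k => by
    rw [← Real.sqrt_mul hK0]
    exact (integral_norm_le_sqrt (hr.memLp_process k)).trans (Real.sqrt_le_sqrt (hD k))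
  obtain ⟨hζ, hζle⟩ := hr.memLp_sum_remainder (γ := γ) m
  have hζi := (hζ.integrable (by norm_num)).norm
  have hinc : ∀ k : ℕ, 0 ≤ (γ ((k : ℝ) + 1))⁻¹ - (γ k)⁻¹ := fun k =>
    sub_nonneg.2 (inv_anti₀ (hγ.pos _ (by positivity))
      (by simpa using hγ.antitone_nat (Nat.le_succ k)))
  have hγ0 := hγ.pos 0 le_rfl
  have hγm := hγ.pos_nat m
  have hinv : ∀ x : ℝ, 0 < x → x⁻¹ * √x = (√x)⁻¹ := fun x hx => by
    have h1 : 0 < √x := Real.sqrt_pos.2 hx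
    have h2 : √x ^ 2 = x := Real.sq_sqrt hx.le
    rw [← h2, Real.sqrt_sq h1.le]
    field_simp
  -- the five terms of the pointwise bound
  have hA : (γ 0)⁻¹ * ∫ ω, ‖process H γ x₀ u 0 ω - c‖ ∂P ≤ √K * (√(γ m))⁻¹ := by
    have h1 : γ m ≤ γ 0 := by simpa using hγ.antitone_nat (Nat.zero_le m)
    have h2 := hE 0
    rw [Nat.cast_zero] at h2
    calc _ ≤ (γ 0)⁻¹ * (√K * √(γ 0)) := by gcongr
      _ = √K * ((γ 0)⁻¹ * √(γ 0)) := by ring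
      _ = √K * (√(γ 0))⁻¹ := by rw [hinv _ hγ0]
      _ ≤ √K * (√(γ m))⁻¹ := by
        have : 0 < √(γ m) := Real.sqrt_pos.2 hγm
        gcongr
  have hBm : (γ m)⁻¹ * ∫ ω, ‖process H γ x₀ u m ω - c‖ ∂P ≤ √K * (√(γ m))⁻¹ := by
    calc _ ≤ (γ m)⁻¹ * (√K * √(γ m)) := by gcongr; exact hE m
      _ = √K * ((γ m)⁻¹ * √(γ m)) := by ring
      _ = √K * (√(γ m))⁻¹ := by rw [hinv _ hγm]
  have hS : ∑ k ∈ Finset.range m, ((γ ((k : ℝ) + 1))⁻¹ - (γ k)⁻¹)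
      * ∫ ω, ‖process H γ x₀ u k ω - c‖ ∂P ≤ √K * ((1 + R) * (√(γ m))⁻¹) := by
    calc _ ≤ ∑ k ∈ Finset.range m, √K * (√(γ k) * ((γ ((k : ℝ) + 1))⁻¹ - (γ k)⁻¹)) := by
          refine Finset.sum_le_sum fun k _ => ?_
          refine (mul_le_mul_of_nonneg_left (hE k) (hinc k)).trans_eq ?_
          ring
      _ ≤ _ := by
          rw [← Finset.mul_sum]
          gcongr
          exact hγ.sum_sqrt_mul_le hR1 hR m
  have hQ : ∑ k ∈ Finset.range m, L * ∫ ω, ‖process H γ x₀ u k ω - c‖ ^ 2 ∂P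
      ≤ L * K * ∑ k ∈ Finset.range m, γ k := by
    rw [← Finset.mul_sum, mul_assoc, Finset.mul_sum (a := K)]
    gcongr with k
    exact hD k
  have hZ : ∫ ω, ‖∑ k ∈ Finset.range m, remainder H f c (process H γ x₀ u k ω) (u k ω)‖ ∂P
      ≤ √(C * K ^ b * ∑ k ∈ Finset.range m, γ k ^ b) := by
    refine (integral_norm_le_sqrt hζ).trans (Real.sqrt_le_sqrt (hζle.trans ?_))
    rw [Finset.mul_sum]
    refine Finset.sum_le_sum fun k _ => ?_
    rw [mul_assoc, ← Real.mul_rpow hK0 (hγ.pos_nat k).le]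
    have : 0 ≤ ∫ ω, ‖process H γ x₀ u k ω - c‖ ^ 2 ∂P := integral_nonneg fun ω => by positivity
    gcongr
    exact hD k
  have hmain : ∫ ω, ‖B (∑ k ∈ Finset.range m, (process H γ x₀ u k ω - c))
      + ∑ k ∈ Finset.range m, H c (u k ω)‖ ∂P
      ≤ √K * (3 + R) * (√(γ m))⁻¹ + L * K * ∑ k ∈ Finset.range m, γ k
        + √(C * K ^ b * ∑ k ∈ Finset.range m, γ k ^ b) := by
    have i1 := (hi 0).const_mul (γ 0)⁻¹
    have i2 := (hi m).const_mul (γ m)⁻¹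
    have i3 : Integrable (fun ω => ∑ k ∈ Finset.range m, ((γ ((k : ℝ) + 1))⁻¹ - (γ k)⁻¹)
        * ‖process H γ x₀ u k ω - c‖) P := integrable_finsetSum _ fun k _ => (hi k).const_mul _
    have i4 : Integrable (fun ω => ∑ k ∈ Finset.range m, L * ‖process H γ x₀ u k ω - c‖ ^ 2) P :=
      integrable_finsetSum _ fun k _ => (hsqi k).const_mul _
    refine (integral_mono ((hr.memLp_linearized m).integrable (by norm_num)).norm
      ((((i1.add i2).add i3).add i4).add hζi) (hr.norm_linearized_le hγ m)).trans ?_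
    have e1 := integral_add i1 i2
    have e2 := integral_add (i1.add i2) i3
    have e3 := integral_add ((i1.add i2).add i3) i4
    have e4 := integral_add (((i1.add i2).add i3).add i4) hζi
    simp only [Pi.add_apply] at e1 e2 e3 e4 ⊢
    rw [e4, e3, e2, e1,
      integral_finsetSum _ fun k _ => (hi k).const_mul _,
      integral_finsetSum _ fun k _ => (hsqi k).const_mul _]
    simp only [integral_const_mul]
    linarith
  calc _ ≤ (√m)⁻¹ * (√K * (3 + R) * (√(γ m))⁻¹ + L * K * ∑ k ∈ Finset.range m, γ k
        + √(C * K ^ b * ∑ k ∈ Finset.range m, γ k ^ b)) := by gcongr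
    _ = _ := by
      have h1 : (√m)⁻¹ * √(C * K ^ b * ∑ k ∈ Finset.range m, γ k ^ b)
          = √(C * K ^ b * ((m : ℝ)⁻¹ * ∑ k ∈ Finset.range m, γ k ^ b)) := by
        rw [← Real.sqrt_inv, ← Real.sqrt_mul (by positivity)]
        congr 1
        ring
      rw [mul_add, h1]
      ring

end Scheme

/-! ### Joint limit of the scheme and of its approximations -/

lemma mul_norm_sub_le_of_le_inner {E : Type*} [NormedAddCommGroup E] [InnerProductSpace ℝ E]
    {lam : ℝ} {x c y : E} (h : lam * ‖x - c‖ ^ 2 ≤ inner ℝ (x - c) y) : lam * ‖x - c‖ ≤ ‖y‖ := by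
  rcases (norm_nonneg (x - c)).eq_or_lt with h0 | h0
  · rw [← h0, mul_zero]
    exact norm_nonneg y
  · have h1 := h.trans (real_inner_le_norm _ _)
    rw [pow_two, ← mul_assoc, mul_comm ‖x - c‖ ‖y‖] at h1
    exact le_of_mul_le_mul_right h1 h0

lemma norm_sub_fderiv_le {E : Type*} [NormedAddCommGroup E] [NormedSpace ℝ E] {f : E → E}
    (hf : Differentiable ℝ f) {L : ℝ≥0} (hL : LipschitzWith L (fderiv ℝ f)) {c : E} (hc : f c = 0)
    (θ : E) : ‖f θ - fderiv ℝ f c (θ - c)‖ ≤ L * ‖θ - c‖ ^ 2 := by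
  have h := (convex_closedBall c ‖θ - c‖).norm_image_sub_le_of_norm_fderiv_le' (f := f)
    (φ := fderiv ℝ f c) (C := L * ‖θ - c‖) (x := c) (y := θ) (fun x _ => hf x)
    (fun x hx => by
      rw [← dist_eq_norm]
      refine (hL.dist_le_mul x c).trans ?_
      gcongr
      exact Metric.mem_closedBall.1 hx)
    (Metric.mem_closedBall_self (norm_nonneg _)) (by simp [dist_eq_norm])
  rw [hc, sub_zero] at h
  exact h.trans_eq (by ring)

lemma toEuclideanCLM_jacobian {d : ℕ} (f : Vec d → Vec d) (x : Vec d) :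
    Matrix.toEuclideanCLM (𝕜 := ℝ) (jacobian f x) = fderiv ℝ f x := by
  ext v i
  rw [Matrix.ofLp_toEuclideanCLM]
  have hv : v = ∑ j, v j • EuclideanSpace.single j (1 : ℝ) := by
    ext i
    simp [Finset.sum_apply, Pi.single_apply]
  conv_rhs => rw [hv]
  simp [Matrix.mulVec, dotProduct, jacobian, mul_comm]

lemma integral_inner_sq {Ω : Type*} [MeasurableSpace Ω] {P : Measure Ω} {d : ℕ} {X : Ω → Vec d}
    (hX : MemLp X 2 P) (y : Vec d) :
    ∫ ω, inner ℝ (X ω) y ^ 2 ∂P = ∑ i, ∑ j, y i * y j * ∫ ω, X ω i * X ω j ∂P := by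
  have hXi : ∀ i, MemLp (fun ω => X ω i) 2 P := fun i =>
    (EuclideanSpace.proj i : Vec d →L[ℝ] ℝ).comp_memLp' hX
  have hij : ∀ i j, Integrable (fun ω => y i * y j * (X ω i * X ω j)) P := fun i j =>
    ((hXi i).integrable_mul (hXi j)).const_mul _
  have h1 : ∀ ω, inner ℝ (X ω) y ^ 2 = ∑ i, ∑ j, y i * y j * (X ω i * X ω j) := fun ω => by
    simp only [PiLp.inner_apply, RCLike.inner_apply, conj_trivial]
    rw [pow_two, Finset.sum_mul_sum]
    exact Finset.sum_congr rfl fun i _ => Finset.sum_congr rfl fun j _ => by ring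
  simp_rw [h1]
  rw [integral_finsetSum _ fun i _ => integrable_finsetSum _ fun j _ => hij i j]
  refine Finset.sum_congr rfl fun i _ => ?_
  rw [integral_finsetSum _ fun j _ => hij i j]
  exact Finset.sum_congr rfl fun j _ => integral_const_mul _ _

lemma tendsto_clm_apply {E F : Type*} [NormedAddCommGroup E] [NormedSpace ℝ E]
    [NormedAddCommGroup F] [NormedSpace ℝ F] {B : ℕ → E →L[ℝ] F} {A : E →L[ℝ] F} {x : ℕ → E} {y : E}
    (hB : Tendsto B atTop (𝓝 A)) (hx : Tendsto x atTop (𝓝 y)) :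
    Tendsto (fun n => B n (x n)) atTop (𝓝 (A y)) :=
  (isBoundedBilinearMap_apply.continuous.tendsto (A, y)).comp (hB.prodMk_nhds hx)

section Limit

variable {d q : ℕ} {H : Vec d → Vec q → Vec d} {γ : ℝ → ℝ}
  {Ω : Type*} [MeasurableSpace Ω] {P : Measure Ω} [IsProbabilityMeasure P]

/-- Rate of convergence of the zeros `c n` of `f n`. -/
lemma tendsto_smul_zero_sub {f : ℕ → Vec d → Vec d} {c : ℕ → Vec d} {B : ℕ → Vec d →L[ℝ] Vec d}
    {lam L : ℝ} (hlam : 0 < lam) {θs e : Vec d} {A : Vec d →L[ℝ] Vec d} (hA : IsUnit A)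
    (hB : Tendsto B atTop (𝓝 A)) {s : ℕ → ℝ} (hs : Tendsto s atTop atTop)
    (hmono : ∀ n, lam * ‖θs - c n‖ ^ 2 ≤ inner ℝ (θs - c n) (f n θs))
    (htaylor : ∀ n, ‖f n θs - B n (θs - c n)‖ ≤ L * ‖θs - c n‖ ^ 2)
    (he : Tendsto (fun n => s n • f n θs) atTop (𝓝 e)) :
    Tendsto (fun n => s n • (c n - θs)) atTop (𝓝 (-(Ring.inverse A e))) := by
  obtain ⟨A', rfl⟩ := hA
  have hG : Tendsto (fun n => Ring.inverse (B n)) atTop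
      (𝓝 (Ring.inverse (A' : Vec d →L[ℝ] Vec d))) :=
    (NormedRing.inverse_continuousAt A').tendsto.comp hB
  have hnorm : ∀ n, ‖θs - c n‖ ≤ lam⁻¹ * ‖f n θs‖ := fun n => by
    rw [le_inv_mul_iff₀ hlam]
    exact mul_norm_sub_le_of_le_inner (hmono n)
  have hf0 : Tendsto (fun n => f n θs) atTop (𝓝 0) := by
    have h1 := hs.inv_tendsto_atTop.smul he
    rw [zero_smul] at h1
    refine h1.congr' ?_
    filter_upwards [hs.eventually_gt_atTop 0] with n hn
    simp [smul_smul, hn.ne']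
  have hrem : Tendsto (fun n => s n • (f n θs - B n (θs - c n))) atTop (𝓝 0) := by
    have h1 := (he.norm.mul hf0.norm).const_mul (|L| * lam⁻¹ ^ 2)
    rw [norm_zero, mul_zero, mul_zero] at h1
    refine squeeze_zero_norm (fun n => ?_) h1
    rw [norm_smul, norm_smul]
    calc ‖s n‖ * ‖f n θs - B n (θs - c n)‖ ≤ ‖s n‖ * (|L| * (lam⁻¹ * ‖f n θs‖) ^ 2) := by
          gcongr
          refine (htaylor n).trans ?_
          gcongr
          · exact le_abs_self L
          · exact hnorm n
      _ = _ := by ring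
  have hlim := (tendsto_clm_apply hG (he.sub hrem)).neg
  rw [sub_zero] at hlim
  refine hlim.congr' ?_
  filter_upwards [hB.eventually (Units.nhds A')] with n hn
  rw [smul_sub (s n) (f n θs), sub_sub_cancel, map_smul]
  have h1 : Ring.inverse (B n) (B n (θs - c n)) = θs - c n := by
    rw [← mul_apply_eq_comp, Ring.inverse_mul_cancel _ hn, one_apply_eq_self]
  rw [h1, ← smul_neg, neg_sub]

/-- Central limit theorem for the averages of a sequence of runs, run `n` being stopped after
`m n ~ (s n)²` iterations. The noise contributes the Gaussian limit and the bias of the zeros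
contributes the shift. -/
theorem tendstoInDistribution_average {a : ℝ} (hγ : IsRegVaryingStep γ a) (ha : 1 / 2 < a)
    (ha' : a < 1) {f : ℕ → Vec d → Vec d} {c : ℕ → Vec d} {B : ℕ → Vec d →L[ℝ] Vec d}
    {V : ℕ → Ω → Vec q} {u : ℕ → ℕ → Ω → Vec q} {x₀ : ℕ → Ω → Vec d} {C b lam L : ℝ}
    (hrun : ∀ n, IsRun P H (f n) (c n) (B n) (V n) (u n) (x₀ n) C b lam L)
    (hb : 0 < b) (hlam : 0 < lam) {θs e : Vec d} {A : Vec d →L[ℝ] Vec d} (hA : IsUnit A)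
    (hB : Tendsto B atTop (𝓝 A)) {s : ℕ → ℝ} (hs : Tendsto s atTop atTop) {m : ℕ → ℕ}
    (hm0 : ∀ n, 0 < (m n : ℝ)) (hm : Tendsto m atTop atTop)
    (hsm : Tendsto (fun n => s n ^ 2 / m n) atTop (𝓝 1))
    (he : Tendsto (fun n => s n • f n θs) atTop (𝓝 e)) {δ : ℝ} (hδ : 0 < δ) {M : ℝ≥0}
    (hM : ∀ n, absMoment P H (V n) (2 + δ) (c n) ≤ M) {Γ : Matrix (Fin d) (Fin d) ℝ}
    (hΓ : Tendsto (fun n => secondMoment P H (V n) (c n)) atTop (𝓝 Γ))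
    {μ : Measure (Vec d)} [IsProbabilityMeasure μ]
    (hμ : ∀ t, charFun μ t = Complex.exp (-((∑ i, ∑ j,
      ContinuousLinearMap.adjoint (Ring.inverse A) t i
        * ContinuousLinearMap.adjoint (Ring.inverse A) t j * Γ i j : ℝ) : ℂ) / 2)) :
    TendstoInDistribution
      (fun n ω => s n • ((m n : ℝ)⁻¹ • ∑ k ∈ Finset.range (m n), process H γ (x₀ n) (u n) k ω - θs))
      atTop (fun z => z + -(Ring.inverse A e)) (fun _ => P) μ := by
  have hG : Tendsto (fun n => Ring.inverse (B n)) atTop (𝓝 (Ring.inverse A)) := by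
    obtain ⟨A', rfl⟩ := hA
    exact (NormedRing.inverse_continuousAt A').tendsto.comp hB
  have hunit : ∀ᶠ n in atTop, IsUnit (B n) := by
    obtain ⟨A', rfl⟩ := hA
    exact hB.eventually (Units.nhds A')
  have hbias := tendsto_smul_zero_sub hlam hA hB hs (fun n => (hrun n).le_inner θs)
    (fun n => (hrun n).taylor θs) he
  set G : ℕ → Vec d →L[ℝ] Vec d := fun n => Ring.inverse (B n)
  have hGH : ∀ n, Measurable fun z => G n (H (c n) z) := fun n =>
    (G n).measurable.comp ((hrun n).measurable_H.comp (measurable_const.prodMk measurable_id))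
  -- the main term
  have hclt : TendstoInDistribution
      (fun n ω => (-(s n / m n)) • ∑ k ∈ Finset.range (m n), G n (H (c n) (u n k ω))) atTop id
      (fun _ => P) μ := by
    obtain ⟨D, hD⟩ := (Metric.isBounded_range_of_tendsto G hG).exists_norm_le
    have hD' : ∀ n, ‖G n‖₊ ≤ D.toNNReal := fun n => by
      rw [← NNReal.coe_le_coe, coe_nnnorm]
      exact (hD _ ⟨n, rfl⟩).trans (Real.le_coe_toNNReal D)
    refine tendstoInDistribution_smul_sum (W := fun n ω => G n (H (c n) (V n ω)))
      (X := fun n k ω => G n (H (c n) (u n k ω)))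
      (fun n k => ((hrun n).identDistrib k).comp (hGH n))
      (fun n => (hrun n).iIndepFun.comp (fun _ z => G n (H (c n) z)) fun _ => hGH n) hm ?_
      (fun n => ?_) hδ (C := D.toNNReal ^ (2 + δ) * M) (fun n => ?_) (fun t => ?_) hμ
    · refine hsm.congr fun n => ?_
      have := hm0 n
      field_simp
    · rw [ContinuousLinearMap.integral_comp_comm _
        (((hrun n).memLp_apply (c n)).integrable (by norm_num)), (hrun n).mean, (hrun n).zero,
        map_zero]
    · calc ∫⁻ ω, ‖G n (H (c n) (V n ω))‖ₑ ^ (2 + δ) ∂P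
          ≤ ∫⁻ ω, (D.toNNReal : ℝ≥0∞) ^ (2 + δ) * ‖H (c n) (V n ω)‖ₑ ^ (2 + δ) ∂P := by
            refine lintegral_mono fun ω => ?_
            rw [← ENNReal.mul_rpow_of_nonneg _ _ (by linarith)]
            gcongr
            refine ((G n).le_opENorm _).trans ?_
            gcongr
            exact ENNReal.coe_le_coe.2 (hD' n)
        _ = (D.toNNReal : ℝ≥0∞) ^ (2 + δ) * absMoment P H (V n) (2 + δ) (c n) := by
            rw [lintegral_const_mul' _ _ (ENNReal.rpow_ne_top_of_nonneg (by linarith)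
              ENNReal.coe_ne_top)]
            rfl
        _ ≤ _ := by
            push_cast
            rw [ENNReal.coe_rpow_of_nonneg _ (by linarith)]
            gcongr
            exact hM n
    · have hadj : Tendsto (fun n => ContinuousLinearMap.adjoint (G n) t) atTop
          (𝓝 (ContinuousLinearMap.adjoint (Ring.inverse A) t)) :=
        tendsto_clm_apply ((ContinuousLinearMap.adjoint.continuous.tendsto _).comp hG)
          tendsto_const_nhds
      have hcoord : ∀ i, Tendsto (fun n => ContinuousLinearMap.adjoint (G n) t i) atTop
          (𝓝 (ContinuousLinearMap.adjoint (Ring.inverse A) t i)) := fun i =>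
        ((EuclideanSpace.proj i : Vec d →L[ℝ] ℝ).continuous.tendsto _).comp hadj
      have hent : ∀ i j, Tendsto (fun n => secondMoment P H (V n) (c n) i j) atTop (𝓝 (Γ i j)) :=
        fun i j => (tendsto_pi_nhds.1 (tendsto_pi_nhds.1 hΓ i)) j
      simp_rw [← ContinuousLinearMap.adjoint_inner_right,
        fun n => integral_inner_sq ((hrun n).memLp_apply (c n))]
      exact tendsto_finsetSum _ fun i _ => tendsto_finsetSum _ fun j _ =>
        ((hcoord i).mul (hcoord j)).mul (hent i j)
  -- the remaining terms converge to a constant in `L¹`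
  obtain ⟨R, hRdef⟩ : ∃ R : ℕ → Ω → Vec d, ∀ n ω, R n ω = s n • (c n - θs) + (s n / m n) •
    (∑ k ∈ Finset.range (m n), (process H γ (x₀ n) (u n) k ω - c n)
      + ∑ k ∈ Finset.range (m n), G n (H (c n) (u n k ω))) := ⟨_, fun _ _ => rfl⟩
  have hRm : ∀ n, Measurable (R n) := fun n => by
    have h1 : Measurable fun ω => ∑ k ∈ Finset.range (m n), (process H γ (x₀ n) (u n) k ω - c n)
        + ∑ k ∈ Finset.range (m n), G n (H (c n) (u n k ω)) :=
      (Finset.measurable_fun_sum _ fun k _ => ((hrun n).measurable_process k).sub_const _).add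
        (Finset.measurable_fun_sum _ fun k _ => (hGH n).comp ((hrun n).measurable_u k))
    rw [show R n = _ from funext (hRdef n)]
    exact (h1.const_smul (s n / m n)).const_add (s n • (c n - θs))
  set κ : Vec d := -(Ring.inverse A e)
  have hR : TendstoInMeasure P R atTop fun _ => κ := by
    obtain ⟨ρ, hρ, hρle⟩ := exists_linearization_error (H := H) (P := P) hγ ha ha'
      (hrun 0).C_nonneg hb hlam (hrun 0).L_nonneg
    have hlim : Tendsto (fun n => ‖s n • (c n - θs) - κ‖
        + √(s n ^ 2 / m n) * (‖G n‖ * ρ (m n))) atTop (𝓝 0) := by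
      have h1 := (tendsto_iff_norm_sub_tendsto_zero.1 hbias).add
        (hsm.sqrt.mul (hG.norm.mul (hρ.comp hm)))
      simpa using h1
    refine tendstoInMeasure_of_tendsto_eLpNorm one_ne_zero
      (fun n => (hRm n).aestronglyMeasurable) aestronglyMeasurable_const ?_
    have hlim' := ENNReal.tendsto_ofReal hlim
    rw [ENNReal.ofReal_zero] at hlim'
    refine tendsto_of_tendsto_of_tendsto_of_le_of_le' tendsto_const_nhds hlim'
      (Eventually.of_forall fun n => zero_le) ?_
    filter_upwards [hunit, hs.eventually_gt_atTop 0] with n hn hsn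
    have hmn := hm0 n
    obtain ⟨F, hF⟩ : ∃ F : Ω → Vec d, ∀ ω, F ω = B n (∑ k ∈ Finset.range (m n),
        (process H γ (x₀ n) (u n) k ω - c n)) + ∑ k ∈ Finset.range (m n), H (c n) (u n k ω) :=
      ⟨_, fun _ => rfl⟩
    have hFi : Integrable F P :=
      (((hrun n).memLp_linearized (m n)).integrable (by norm_num)).congr
        (Eventually.of_forall fun ω => (hF ω).symm)
    have hGF : ∀ ω, R n ω - κ = (s n • (c n - θs) - κ) + (s n / m n) • G n (F ω) := fun ω => by
      have h1 : ∀ v, G n (B n v) = v := fun v => by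
        rw [← mul_apply_eq_comp, Ring.inverse_mul_cancel _ hn, one_apply_eq_self]
      rw [hRdef, hF, map_add, h1, map_sum]
      abel
    have hbound : ∀ ω, ‖R n ω - κ‖ ≤ ‖s n • (c n - θs) - κ‖
        + s n / m n * (‖G n‖ * ‖F ω‖) := fun ω => by
      rw [hGF]
      refine (norm_add_le _ _).trans ?_
      gcongr
      rw [norm_smul, Real.norm_of_nonneg (by positivity)]
      gcongr
      exact (G n).le_opNorm _
    have hFi' : Integrable (fun ω => s n / m n * (‖G n‖ * ‖F ω‖)) P :=
      (hFi.norm.const_mul _).const_mul _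
    have hbi : Integrable (fun ω => ‖s n • (c n - θs) - κ‖ + s n / m n * (‖G n‖ * ‖F ω‖)) P :=
      (integrable_const _).add hFi'
    have hint : ∫ ω, (‖s n • (c n - θs) - κ‖ + s n / m n * (‖G n‖ * ‖F ω‖)) ∂P
        ≤ ‖s n • (c n - θs) - κ‖ + √(s n ^ 2 / m n) * (‖G n‖ * ρ (m n)) := by
      rw [integral_add (integrable_const _) hFi', integral_const_mul, integral_const_mul]
      simp only [integral_const, probReal_univ, one_smul]
      have h2 := hρle _ _ _ _ _ _ (hrun n) (m n)
      simp_rw [← hF] at h2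
      have h4 : 0 < √(m n : ℝ) := Real.sqrt_pos.2 hmn
      have h3 : √(s n ^ 2 / m n) = s n / m n * √(m n : ℝ) := by
        rw [Real.sqrt_div (sq_nonneg _), Real.sqrt_sq hsn.le]
        have : √(m n : ℝ) ^ 2 = m n := Real.sq_sqrt hmn.le
        field_simp
        rw [this]
      have h5 : s n / m n * (‖G n‖ * ∫ ω, ‖F ω‖ ∂P)
          = s n / m n * √(m n : ℝ) * (‖G n‖ * ((√(m n : ℝ))⁻¹ * ∫ ω, ‖F ω‖ ∂P)) := by
        field_simp
      rw [h5, h3]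
      gcongr
    rw [eLpNorm_one_eq_lintegral_enorm]
    calc ∫⁻ ω, ‖R n ω - κ‖ₑ ∂P
        ≤ ∫⁻ ω, ENNReal.ofReal (‖s n • (c n - θs) - κ‖ + s n / m n * (‖G n‖ * ‖F ω‖)) ∂P := by
          refine lintegral_mono fun ω => ?_
          rw [← ofReal_norm]
          exact ENNReal.ofReal_le_ofReal (hbound ω)
      _ = ENNReal.ofReal (∫ ω, (‖s n • (c n - θs) - κ‖ + s n / m n * (‖G n‖ * ‖F ω‖)) ∂P) :=
          (ofReal_integral_eq_lintegral_ofReal hbi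
            (Eventually.of_forall fun ω => by positivity)).symm
      _ ≤ _ := ENNReal.ofReal_le_ofReal hint
  have hslutsky := hclt.add_of_tendstoInMeasure_const hR fun n => (hRm n).aemeasurable
  convert! hslutsky using 2 with n
  funext ω
  have hmn := (hm0 n).ne'
  simp only [hRdef, Pi.add_apply, Finset.sum_sub_distrib, Finset.sum_const, Finset.card_range,
    ← Nat.cast_smul_eq_nsmul ℝ]
  match_scalars <;> field_simp <;> ring

end Limit

/-! ### Number of steps and cost -/

lemma tendsto_sq_div_numSteps {α : ℝ} (hα : 0 < α) :
    Tendsto (fun n : ℕ => ((n : ℝ) ^ α) ^ 2 / ((numSteps α n + 1 : ℕ) : ℝ)) atTop (𝓝 1) := by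
  have hx : Tendsto (fun n : ℕ => (n : ℝ) ^ (2 * α)) atTop atTop :=
    (tendsto_rpow_atTop (by linarith)).comp tendsto_natCast_atTop_atTop
  have h1 : Tendsto (fun n : ℕ => (⌊(n : ℝ) ^ (2 * α)⌋₊ : ℝ) / (n : ℝ) ^ (2 * α)
      + ((n : ℝ) ^ (2 * α))⁻¹) atTop (𝓝 (1 + 0)) :=
    (tendsto_nat_floor_div_atTop.comp hx).add hx.inv_tendsto_atTop
  have h2 := h1.inv₀ (by norm_num)
  rw [add_zero, inv_one] at h2
  refine h2.congr fun n => ?_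
  have h3 : ((n : ℝ) ^ α) ^ 2 = (n : ℝ) ^ (2 * α) := by
    rw [← Real.rpow_natCast, ← Real.rpow_mul (Nat.cast_nonneg n)]
    congr 1
    push_cast
    ring
  rw [h3, numSteps, inv_eq_one_div, ← one_div, ← add_div, one_div_div]
  push_cast
  rfl

lemma tendsto_numSteps {α : ℝ} (hα : 0 < α) : Tendsto (numSteps α) atTop atTop :=
  tendsto_nat_floor_atTop.comp
    ((tendsto_rpow_atTop (by linarith)).comp tendsto_natCast_atTop_atTop)

lemma simulationCost_isEquivalent {α : ℝ} (hα : 0 < α) (K : ℝ) :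
    (fun n : ℕ => simulationCost K n (numSteps α n))
      ~[atTop] fun n : ℕ => K * (n : ℝ) ^ (2 * α + 1) := by
  have hx : Tendsto (fun n : ℕ => (n : ℝ) ^ (2 * α)) atTop atTop :=
    (tendsto_rpow_atTop (by linarith)).comp tendsto_natCast_atTop_atTop
  have h1 := (isEquivalent_nat_floor.comp_tendsto hx).mul
    (IsEquivalent.refl (u := fun n : ℕ => K * (n : ℝ)))
  refine (h1.congr_left (Eventually.of_forall fun n => ?_)).congr_right ?_
  · simp [simulationCost, numSteps]
  · filter_upwards [eventually_gt_atTop 0] with n hn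
    have hn' : (0 : ℝ) < n := by exact_mod_cast hn
    simp only [Pi.mul_apply, Function.comp]
    rw [Real.rpow_add hn', Real.rpow_one]
    ring

/-- The quadratic form of `J⁻¹ Γ J⁻ᵀ` at `t` is that of `Γ` at `(J⁻¹)ᵀ t`, the form in which it
arises as the limit of the variances of the linearized noise. -/
lemma charFun_multivariateGaussian_conj {d : ℕ} {J Γ : Matrix (Fin d) (Fin d) ℝ}
    (hΓ : Γ.PosSemidef) (t : Vec d) :
    charFun (multivariateGaussian 0 (J⁻¹ * Γ * J⁻¹.transpose)) t = Complex.exp (-((∑ i, ∑ j,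
      ContinuousLinearMap.adjoint (Matrix.toEuclideanCLM (𝕜 := ℝ) J⁻¹) t i
        * ContinuousLinearMap.adjoint (Matrix.toEuclideanCLM (𝕜 := ℝ) J⁻¹) t j
        * Γ i j : ℝ) : ℂ) / 2) := by
  have hS : (J⁻¹ * Γ * J⁻¹.transpose).PosSemidef := by
    have := hΓ.mul_mul_conjTranspose_same J⁻¹
    rwa [Matrix.conjTranspose_eq_transpose_of_trivial] at this
  have hadj : ContinuousLinearMap.adjoint (Matrix.toEuclideanCLM (𝕜 := ℝ) J⁻¹)
      = Matrix.toEuclideanCLM (𝕜 := ℝ) J⁻¹.transpose := by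
    rw [← ContinuousLinearMap.star_eq_adjoint, ← map_star, Matrix.star_eq_conjTranspose,
      Matrix.conjTranspose_eq_transpose_of_trivial]
  have hquad : (t : Vec d).ofLp ⬝ᵥ (J⁻¹ * Γ * J⁻¹.transpose).mulVec t.ofLp = ∑ i, ∑ j,
      ContinuousLinearMap.adjoint (Matrix.toEuclideanCLM (𝕜 := ℝ) J⁻¹) t i
        * ContinuousLinearMap.adjoint (Matrix.toEuclideanCLM (𝕜 := ℝ) J⁻¹) t j * Γ i j := by
    rw [hadj]
    simp only [Matrix.ofLp_toEuclideanCLM]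
    rw [← Matrix.mulVec_mulVec, ← Matrix.mulVec_mulVec, Matrix.dotProduct_mulVec,
      ← Matrix.mulVec_transpose]
    simp only [dotProduct, Matrix.mulVec, Finset.mul_sum]
    exact Finset.sum_congr rfl fun i _ => Finset.sum_congr rfl fun j _ => by
      rw [Finset.sum_mul]
      exact Finset.sum_congr rfl fun k _ => by ring
  rw [charFun_multivariateGaussian hS, inner_zero_right, hquad]
  simp [neg_div]

end

end StochApprox

theorem theorem2p8
    {Ω : Type*} [MeasurableSpace Ω] (P : Measure Ω) [IsProbabilityMeasure P]
    {d q : ℕ}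
    (H : StochApprox.Vec d → StochApprox.Vec q → StochApprox.Vec d)
    (hH : Measurable (Function.uncurry H))
    -- the target `U`, its approximations `Uⁿ` (`n ≥ 1`), and the mean fields `h` and `hⁿ`
    (U : Ω → StochApprox.Vec q) (hU : Measurable U)
    (Un : ℕ → Ω → StochApprox.Vec q) (hUn : ∀ n, 1 ≤ n → Measurable (Un n))
    (h : StochApprox.Vec d → StochApprox.Vec d)
    (h_def : h = StochApprox.meanField P H U)
    (hn : ℕ → StochApprox.Vec d → StochApprox.Vec d)
    (hn_def : ∀ n, hn n = StochApprox.meanField P H (Un n))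
    -- their zeros, and the mean-reverting assumption
    (θs : StochApprox.Vec d) (hθs : h θs = 0)
    (h_meanRev : StochApprox.MeanReverting h θs)
    (θsn : ℕ → StochApprox.Vec d) (hθsn : ∀ n, 1 ≤ n → hn n (θsn n) = 0)
    (hn_meanRev : ∀ n, 1 ≤ n → StochApprox.MeanReverting (hn n) (θsn n))
    -- regularity of the mean fields, convergence, and the weak error of order `n^{-α}`
    (h_C1 : ContDiff ℝ 1 h) (h_C2 : ContDiffAt ℝ 2 h θs)
    (hn_C2 : ∀ n, 1 ≤ n → ContDiff ℝ 2 (hn n))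
    (hn_lip : ∃ L : ℝ≥0, ∀ n, 1 ≤ n → LipschitzWith L (fderiv ℝ (hn n)))
    (hn_tendsto : TendstoLocallyUniformly hn h atTop)
    (Dhn_tendsto : TendstoLocallyUniformly (fun n => fderiv ℝ (hn n)) (fderiv ℝ h) atTop)
    (Dh_nonsing : IsUnit (StochApprox.jacobian h θs))
    (Dh_stable : StochApprox.IsStable (StochApprox.jacobian h θs))
    (α : ℝ) (hα : 0 < α)
    (Eh : StochApprox.Vec d → StochApprox.Vec d)
    (weak_error : ∀ θ, Tendsto (fun n : ℕ => (n : ℝ) ^ α • (hn n θ - h θ)) atTop (𝓝 (Eh θ)))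
    -- moment assumptions on `H(θ, U)`
    (U_moment : ∃ ε : ℝ, 0 < ε ∧ ∀ R : ℝ, 0 < R → ∃ C : ℝ≥0, ∀ θ, ‖θ‖ ≤ R →
      StochApprox.absMoment P H U (2 + ε) θ ≤ C)
    (Γ_cont : Continuous (StochApprox.secondMoment P H U))
    (Γ_posDef : (StochApprox.secondMoment P H U θs).PosDef)
    -- uniform Hölder regularity in mean square
    (HR : ∃ b : ℝ, 0 < b ∧ b ≤ 1 ∧ ∃ C : ℝ, ∀ n, 1 ≤ n → ∀ θ θ' : StochApprox.Vec d,
      ∫⁻ ω, ‖H θ (Un n ω) - H θ' (Un n ω)‖ₑ ^ (2 : ℝ) ∂P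
        ≤ ENNReal.ofReal (C * ‖θ - θ'‖ ^ (2 * b)))
    -- uniform moment assumptions on `H(θ, Uⁿ)`
    (HI_moment : ∃ δ : ℝ, 0 < δ ∧ ∀ R : ℝ, 0 < R → ∃ C : ℝ≥0, ∀ n, 1 ≤ n → ∀ θ, ‖θ‖ ≤ R →
      StochApprox.absMoment P H (Un n) (2 + δ) θ ≤ C)
    (HI_tendsto : TendstoLocallyUniformly (fun n => StochApprox.secondMoment P H (Un n))
      (StochApprox.secondMoment P H U) atTop)
    -- uniform mean reversion
    (HMR : ∃ lam : ℝ, 0 < lam ∧ ∀ n, 1 ≤ n → ∀ θ,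
      lam * ‖θ - θsn n‖ ^ 2 ≤ inner ℝ (θ - θsn n) (hn n θ))
    -- the slowly decreasing step
    (γ : ℝ → ℝ) (a : ℝ) (ha : 1 / 2 < a) (ha' : a < 1)
    (HS1 : StochApprox.IsRegVaryingStep γ a)
    -- the innovations `ξ n 0, ξ n 1, …` (i.i.d. copies of `Uⁿ`) and the initial values
    (ξ : ℕ → ℕ → Ω → StochApprox.Vec q) (ξ_meas : ∀ n, 1 ≤ n → ∀ p, Measurable (ξ n p))
    (ξ_law : ∀ n, 1 ≤ n → ∀ p, IdentDistrib (ξ n p) (Un n) P P)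
    (ξ_indep : ∀ n, 1 ≤ n → iIndepFun (ξ n) P)
    (θ₀ : ℕ → Ω → StochApprox.Vec d) (θ₀_meas : ∀ n, 1 ≤ n → Measurable (θ₀ n))
    (θ₀_indep : ∀ n, 1 ≤ n → IndepFun (θ₀ n) (fun ω p => ξ n p ω) P)
    (θ₀_moment : ∃ C : ℝ≥0, ∀ n, 1 ≤ n → ∫⁻ ω, ‖θ₀ n ω‖ₑ ^ (2 : ℝ) ∂P ≤ C) :
    TendstoInDistribution
      (fun (n : ℕ) (ω : Ω) => (n : ℝ) ^ α •
        (StochApprox.average H γ (θ₀ n ω) (fun p => ξ n p ω) (StochApprox.numSteps α n) - θs))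
      atTop
      (fun z : StochApprox.Vec d =>
        -(Matrix.toEuclideanCLM (𝕜 := ℝ) (StochApprox.jacobian h θs)⁻¹ (Eh θs)) + z)
      (fun _ => P)
      (multivariateGaussian 0
        ((StochApprox.jacobian h θs)⁻¹ * StochApprox.secondMoment P H U θs *
          ((StochApprox.jacobian h θs)⁻¹).transpose))
    ∧ ∀ K : ℝ, 0 < K →
      (fun n : ℕ => StochApprox.simulationCost K n (StochApprox.numSteps α n))
        ~[atTop] fun n : ℕ => K * (n : ℝ) ^ (2 * α + 1) := by
  refine ⟨?_, fun K _ => StochApprox.simulationCost_isEquivalent hα K⟩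
  obtain ⟨L, hL⟩ := hn_lip
  obtain ⟨b, hb0, hb1, C₁, hHR⟩ := HR
  obtain ⟨δ, hδ, hHI⟩ := HI_moment
  obtain ⟨lam, hlam, hmono⟩ := HMR
  obtain ⟨C₃, hC₃⟩ := θ₀_moment
  have hα0 : Tendsto (fun n : ℕ => (n : ℝ) ^ α) atTop atTop :=
    (tendsto_rpow_atTop hα).comp tendsto_natCast_atTop_atTop
  -- convergence of the zeros
  have he : Tendsto (fun n : ℕ => (n : ℝ) ^ α • hn n θs) atTop (𝓝 (Eh θs)) := by
    simpa [hθs] using weak_error θs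
  have hn0 : Tendsto (fun n => hn n θs) atTop (𝓝 0) := by
    have h1 := hα0.inv_tendsto_atTop.smul he
    rw [zero_smul] at h1
    refine h1.congr' ?_
    filter_upwards [hα0.eventually_gt_atTop 0] with n hn
    simp [smul_smul, hn.ne']
  have hc' : Tendsto (fun n => θsn (n + 1)) atTop (𝓝 θs) := by
    rw [tendsto_iff_norm_sub_tendsto_zero]
    have h1 : Tendsto (fun n => lam⁻¹ * ‖hn (n + 1) θs‖) atTop (𝓝 0) := by
      simpa using ((hn0.comp (tendsto_add_atTop_nat 1)).norm).const_mul lam⁻¹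
    refine squeeze_zero (fun n => norm_nonneg _) (fun n => ?_) h1
    rw [norm_sub_rev, le_inv_mul_iff₀ hlam]
    exact StochApprox.mul_norm_sub_le_of_le_inner (hmono (n + 1) n.succ_pos θs)
  obtain ⟨R, hR⟩ := (Metric.isBounded_range_of_tendsto _ hc').exists_norm_le
  replace hR : ∀ n, ‖θsn (n + 1)‖ ≤ max R 1 := fun n => (hR _ ⟨n, rfl⟩).trans (le_max_left _ _)
  -- `max R 1`, since the moment bound is assumed for positive radii only
  obtain ⟨C₂, hC₂⟩ := hHI (max R 1) (lt_max_of_lt_right one_pos)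
  -- the constants that are common to all runs
  set C : ℝ := max (max C₁ (1 + C₂)) (2 * (C₃ + (max R 1) ^ 2))
  have hCC₁ : C₁ ≤ C := (le_max_left _ _).trans (le_max_left _ _)
  have hCC₂ : 1 + C₂ ≤ C := (le_max_right _ _).trans (le_max_left _ _)
  have hCC₃ : 2 * (C₃ + (max R 1) ^ 2) ≤ C := le_max_right _ _
  have hrun : ∀ n, StochApprox.IsRun P H (hn (n + 1)) (θsn (n + 1))
      (fderiv ℝ (hn (n + 1)) (θsn (n + 1))) (Un (n + 1)) (ξ (n + 1)) (θ₀ (n + 1)) C b lam L := by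
    intro n
    have hn1 : 1 ≤ n + 1 := n.succ_pos
    refine
      { measurable_H := hH
        measurable_V := hUn _ hn1
        measurable_u := ξ_meas _ hn1
        measurable_init := θ₀_meas _ hn1
        identDistrib := ξ_law _ hn1
        iIndepFun := ξ_indep _ hn1
        indepFun := θ₀_indep _ hn1
        mean := fun θ => by rw [hn_def]; rfl
        continuous := (hn_C2 _ hn1).continuous
        zero := hθsn _ hn1
        C_nonneg := le_trans (by positivity) hCC₂
        b_nonneg := hb0.le
        b_le := hb1
        L_nonneg := L.2
        holder := fun θ θ' => (hHR _ hn1 θ θ').trans (ENNReal.ofReal_le_ofReal (by gcongr))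
        sq_le := ?_
        init_le := ?_
        le_inner := hmono _ hn1
        taylor := fun θ => StochApprox.norm_sub_fderiv_le
          ((hn_C2 _ hn1).differentiable (by norm_num)) (hL _ hn1) (hθsn _ hn1) θ }
    · calc ∫⁻ ω, ‖H (θsn (n + 1)) (Un (n + 1) ω)‖ₑ ^ (2 : ℝ) ∂P
          ≤ ∫⁻ ω, (1 + ‖H (θsn (n + 1)) (Un (n + 1) ω)‖ₑ ^ (2 + δ)) ∂P := by
            refine lintegral_mono fun ω => ?_
            rcases le_total ‖H (θsn (n + 1)) (Un (n + 1) ω)‖ₑ 1 with h1 | h1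
            · exact (ENNReal.rpow_le_one h1 (by norm_num)).trans le_self_add
            · exact (ENNReal.rpow_le_rpow_of_exponent_le h1 (by linarith)).trans le_add_self
        _ ≤ 1 + C₂ := by
            rw [lintegral_add_left measurable_const]
            simpa [StochApprox.absMoment] using hC₂ (n + 1) hn1 _ (hR n)
        _ = ENNReal.ofReal (1 + C₂) := by
            rw [ENNReal.ofReal_add zero_le_one C₂.coe_nonneg]; simp
        _ ≤ _ := ENNReal.ofReal_le_ofReal hCC₂
    · calc ∫⁻ ω, ‖θ₀ (n + 1) ω - θsn (n + 1)‖ₑ ^ (2 : ℝ) ∂P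
          ≤ ∫⁻ ω, 2 * (‖θ₀ (n + 1) ω‖ₑ ^ (2 : ℝ) + ‖θsn (n + 1)‖ₑ ^ (2 : ℝ)) ∂P := by
            refine lintegral_mono fun ω => ?_
            refine (ENNReal.rpow_le_rpow (enorm_sub_le) (by norm_num)).trans ?_
            refine (ENNReal.rpow_add_le_mul_rpow_add_rpow _ _
              (by norm_num : (1 : ℝ) ≤ 2)).trans_eq ?_
            norm_num
        _ = 2 * (∫⁻ ω, ‖θ₀ (n + 1) ω‖ₑ ^ (2 : ℝ) ∂P + ‖θsn (n + 1)‖ₑ ^ (2 : ℝ)) := by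
            rw [lintegral_const_mul' _ _ (by norm_num), lintegral_add_right _ measurable_const]
            simp
        _ ≤ 2 * (C₃ + ENNReal.ofReal ((max R 1) ^ 2)) := by
            gcongr
            · exact hC₃ _ hn1
            · rw [← ofReal_norm, ENNReal.ofReal_rpow_of_nonneg (norm_nonneg _) (by norm_num),
                Real.rpow_two]
              exact ENNReal.ofReal_le_ofReal (by gcongr; exact hR n)
        _ = ENNReal.ofReal (2 * (C₃ + (max R 1) ^ 2)) := by
            rw [ENNReal.ofReal_mul (by norm_num), ENNReal.ofReal_add C₃.coe_nonneg (by positivity)]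
            simp
        _ ≤ _ := ENNReal.ofReal_le_ofReal hCC₃
  -- convergence of the derivatives and of the covariances at the zeros
  have hDh : Continuous (fderiv ℝ h) := h_C1.continuous_fderiv (by norm_num)
  have hshift : Tendsto (fun n : ℕ => n + 1) atTop atTop := tendsto_add_atTop_nat 1
  have hc : Tendsto θsn atTop (𝓝 θs) := (tendsto_add_atTop_iff_nat 1).1 hc'
  have hB : Tendsto (fun n => fderiv ℝ (hn (n + 1)) (θsn (n + 1))) atTop (𝓝 (fderiv ℝ h θs)) :=
    (Dhn_tendsto.tendsto_comp hDh.continuousAt hc).comp hshift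
  have hΓ : Tendsto (fun n => StochApprox.secondMoment P H (Un (n + 1)) (θsn (n + 1))) atTop
      (𝓝 (StochApprox.secondMoment P H U θs)) :=
    (HI_tendsto.tendsto_comp Γ_cont.continuousAt hc).comp hshift
  set J := StochApprox.jacobian h θs
  have hJ : Matrix.toEuclideanCLM (𝕜 := ℝ) J = fderiv ℝ h θs :=
    StochApprox.toEuclideanCLM_jacobian h θs
  have hA : IsUnit (fderiv ℝ h θs) := hJ ▸ Dh_nonsing.map _
  have hinv : Ring.inverse (fderiv ℝ h θs) = Matrix.toEuclideanCLM (𝕜 := ℝ) J⁻¹ := by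
    have h1 : Matrix.toEuclideanCLM (𝕜 := ℝ) J⁻¹ * fderiv ℝ h θs = 1 := by
      rw [← hJ, ← map_mul, Matrix.nonsing_inv_mul _ ((Matrix.isUnit_iff_isUnit_det _).1 Dh_nonsing),
        map_one]
    calc Ring.inverse (fderiv ℝ h θs)
        = Matrix.toEuclideanCLM (𝕜 := ℝ) J⁻¹ * fderiv ℝ h θs * Ring.inverse (fderiv ℝ h θs) := by
          rw [h1, one_mul]
      _ = _ := by rw [mul_assoc, Ring.mul_inverse_cancel _ hA, mul_one]
  -- rows are shifted by one, and the average of `θ_0, …, θ_p` has `p + 1` terms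
  have hmain := StochApprox.tendstoInDistribution_average HS1 ha ha' hrun hb0 hlam hA hB
    (s := fun n : ℕ => ((n + 1 : ℕ) : ℝ) ^ α) (hα0.comp hshift)
    (m := fun n => StochApprox.numSteps α (n + 1) + 1) (fun n => by positivity)
    (tendsto_atTop_mono (fun n => Nat.le_succ _)
      ((StochApprox.tendsto_numSteps hα).comp hshift))
    ((StochApprox.tendsto_sq_div_numSteps hα).comp hshift) (he.comp hshift) hδ
    (fun n => hC₂ (n + 1) n.succ_pos _ (hR n)) hΓ
    (μ := multivariateGaussian 0 (J⁻¹ * StochApprox.secondMoment P H U θs * J⁻¹.transpose))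
    (fun t => by
      rw [hinv]
      exact StochApprox.charFun_multivariateGaussian_conj Γ_posDef.posSemidef t)
  rw [hinv] at hmain
  have hX : ∀ n : ℕ, (fun ω : Ω => ((n + 1 : ℕ) : ℝ) ^ α •
      (((StochApprox.numSteps α (n + 1) + 1 : ℕ) : ℝ)⁻¹ •
        ∑ k ∈ Finset.range (StochApprox.numSteps α (n + 1) + 1),
          StochApprox.process H γ (θ₀ (n + 1)) (ξ (n + 1)) k ω - θs))
      = fun ω => ((n + 1 : ℕ) : ℝ) ^ α • (StochApprox.average H γ (θ₀ (n + 1) ω)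
        (fun p => ξ (n + 1) p ω) (StochApprox.numSteps α (n + 1)) - θs) := fun n => by
    funext ω
    simp only [StochApprox.average, StochApprox.process]
    push_cast
    rfl
  replace hmain := hmain.congr (fun n => Eventually.of_forall fun ω => congrFun (hX n) ω)
    EventuallyEq.rfl
  refine ⟨fun n => ?_, by fun_prop, ?_⟩
  · -- the index `0`, where nothing is assumed, contributes the constant `0`
    rcases n with _ | n
    · simp [Real.zero_rpow hα.ne']
    · exact hmain.forall_aemeasurable n
  · refine (tendsto_add_atTop_iff_nat 1).1 ?_
    simpa only [add_comm] using hmain.tendsto
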